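/- **Setting.** Let $(M,\omega)$ be a compact simply connected symplectic manifold of dimension $2n$ and let $L\to M$ be a smooth Hermitian line bundle with a Hermitian connection $a$ whose curvature is $F_a=2\pi i\,\omega$ (prequantization data). Let $\Gamma(M,L)$ be the space of smooth sections with the $L^2$ inner product given by the Hermitian structure and the Liouville measure. Fix a compact connected oriented $n$-manifold $S_0$ and a class in $H_n(M,\mathbb Z)$, and let $\mathcal B_S$ be the space of Lagrangian submanifolds $S\subset M$ which are embedded images of $S_0$ in this class and satisfy the Bohr–Sommerfeld condition: $(L,a)|_S$ has a nowhere vanishing covariantly constant section $\sigma_S$. Let $$\mathcal U_{SBS}(a)=\Big\{([\alpha],S)\in\mathbb P\Gamma(M,L)\times\mathcal B_S\ :\ \alpha|_S=e^{ic}f\,\sigma_S,\ c\in\mathbb R,\ f\in C^\infty(S,\mathbb R_{>0})\Big\}.$$ Let $\mathcal O(1)\to\mathbb P\Gamma(M,L)$ be the $U(1)$-bundle whose fibre over $p$ consists of the linear functionals of norm one on the line $p\subset\Gamma(M,L)$, with the $U(1)$-action induced from the one on $L$, i.e. $(g\xi)(s)=\xi(g^{-1}s)$. Let $\mathcal P_S(a)\to\mathcal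 B_S$ be the $U(1)$-bundle whose fibre over $S$ consists of the covariantly constant sections of $(L,a)|_S$ of length one. An element $\xi\in\mathcal O(1)_p$ has the form $\xi=\langle s,\cdot\rangle_{L^2}$ for a unique unit $s\in p$; its pairing with $\sigma\in\mathcal P_S(a)_S$ is the function $x\mapsto h(s(x),\sigma(x))$ on $S$, where $h$ is the Hermitian structure, conjugate linear in the first argument. Let $p_1,p_2$ be the projections of $\mathbb P\Gamma(M,L)\times\mathcal B_S$. For a subset $V$, a *canonical isomorphism over $V$* is an isomorphism of $U(1)$-bundles $p_1^*\mathcal O(1)|_V\cong p_2^*\mathcal P_S(a)|_V$ under which corresponding elements have real, strictly positive pairing along $S$. All spaces carry the smooth structures in which a finite-dimensional family of (lines of) sections, of submanifolds or of lifted submanifolds is smooth if it is locally given by a jointly smooth family of (non-zero) sections, of embeddings of $S_0$ into $M$, or of maps of $S_0$ to $L$. **Statement.** 1. There is exactly one canonical isomorphism $p_1^*\mathcal O(1)\cong p_2^*\mathcal P_S(a)$ over $\mathcal U_{SBS}(a)$. 2. $\mathcal U_{SBS}(a)$ is the largest subset with this property: every subset $V\subset\mathbb P\Gamma(M,L)\times\mathcal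 B_S$ over which there is a canonical isomorphism is contained in $\mathcal U_{SBS}(a)$. 3. Let $\mathcal L\to\mathcal U_{SBS}(a)$ be the set of pairs $(\xi,\sigma)$ in the fibre product of $p_1^*\mathcal O(1)$ and $p_2^*\mathcal P_S(a)$ over $\mathcal U_{SBS}(a)$ with real, strictly positive pairing along $S$. Then $\mathcal L$ is a (locally trivial, smooth) principal $U(1)$-bundle, and its two projections are isomorphisms of $U(1)$-bundles onto $p_1^*\mathcal O(1)|_{\mathcal U_{SBS}(a)}$ and $p_2^*\mathcal P_S(a)|_{\mathcal U_{SBS}(a)}$. 4. Let $A$ be the standard Hermitian connection of $\mathcal O(1)$, with connection form $i\,\mathrm{Im}\langle s,ds\rangle_{L^2}$ in terms of the unit section $s$ with $\xi=\langle s,\cdot\rangle_{L^2}$. Then $\tilde A=p_1^*A$ is a connection on the $U(1)$-bundle $\mathcal L$, and its curvature is $F_{\tilde A}=2\pi i\,p_1^*\Omega_{FS}$, where $\Omega_{FS}$ is the Fubini–Study form of $\mathbb P\Gamma(M,L)$, normalised to have integral $1$ over a projective line: $$\Omega_{FS}(v,w)=\frac1\pi\,\mathrm{Im}\left(\frac{\langle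 v,w\rangle}{\langle\alpha,\alpha\rangle}-\frac{\langle v,\alpha\rangle\langle\alpha,w\rangle}{\langle\alpha,\alpha\rangle^2}\right)\quad\text{at }[\alpha].$$ -/

import Mathlib

open scoped Manifold ContDiff Topology InnerProductSpace LinearAlgebra.Projectivization
open MeasureTheory Diffeology Bundle Manifold

set_option linter.unusedSectionVars false

noncomputable section

/-! ## Generalities on diffeological spaces

Infinite-dimensional spaces of sections and of submanifolds are given their smooth structure by
specifying which finite-parameter families are smooth (Mathlib's `DiffeologicalSpace`). -/

namespace SBS

/-- The parameter spaces `ℝᵏ` of smooth families. -/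
abbrev Eu (k : ℕ) : Type := EuclideanSpace ℝ (Fin k)

/-- The diffeology whose plots are the maps having the property `P p u` (`p` is smooth near `u`)
at every point `u` of the parameter space. -/
@[reducible]
def diffeologyOfLocal {X : Type*} (P : ∀ ⦃k : ℕ⦄, (Eu k → X) → Eu k → Prop)
    (hcongr : ∀ ⦃k : ℕ⦄ (p q : Eu k → X) (u : Eu k), p =ᶠ[𝓝 u] q → P p u → P q u)
    (hconst : ∀ ⦃k : ℕ⦄ (x : X) (u : Eu k), P (fun _ => x) u)
    (hcomp : ∀ ⦃k m : ℕ⦄ (p : Eu k → X) (f : Eu m → Eu k) (v : Set (Eu m)) (u : Eu m),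
      IsOpen v → u ∈ v → ContDiffOn ℝ ∞ f v → P p (f u) → P (p ∘ f) u) :
    DiffeologicalSpace X :=
  .ofCorePlotsOn
    { isPlotOn := fun {_ s} _ p => ∀ u ∈ s, P p u
      isPlotOn_congr := fun {_ s} hs p q h =>
        ⟨fun H u hu => hcongr p q u (h.eventuallyEq_of_mem (hs.mem_nhds hu)) (H u hu),
         fun H u hu => hcongr q p u (h.symm.eventuallyEq_of_mem (hs.mem_nhds hu)) (H u hu)⟩
      isPlot := fun p => ∀ u, P p u
      isPlotOn_univ := by simp
      isPlot_const := fun x u => hconst x u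
      isPlotOn_reparam := fun {_ _ _ v _} hv p f h hp hf u hu =>
        hcomp p f v u hv hu hf (hp (f u) (h hu))
      locality := fun {_ s} _ p hp u hu => by
        obtain ⟨v, _, huv, H⟩ := hp u hu
        exact H u huv }

/-- The diffeology induced by a map: `p` is a plot iff `f ∘ p` is. -/
@[reducible]
def inducedDiffeology {X Y : Type*} [DiffeologicalSpace Y] (f : X → Y) : DiffeologicalSpace X where
  plots k := {p : Eu k → X | IsPlot (f ∘ p)}
  constant_plots _ := isPlot_const
  plot_reparam {_ _ p _} hp hf := isPlot_reparam (p := f ∘ p) hp hf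
  locality {n p} hp := DiffeologicalSpace.locality (p := f ∘ p) fun x => by
    obtain ⟨u, hu, hx, H⟩ := hp x
    exact ⟨u, hu, hx, fun hf hf' => H hf hf'⟩

/-- Subspace diffeology. -/
instance {X : Type*} [DiffeologicalSpace X] (p : X → Prop) : DiffeologicalSpace (Subtype p) :=
  inducedDiffeology Subtype.val

/-- Product diffeology. -/
instance {X Y : Type*} [DiffeologicalSpace X] [DiffeologicalSpace Y] :
    DiffeologicalSpace (X × Y) :=
  inducedDiffeology Prod.fst ⊓ inducedDiffeology Prod.snd

/-- `U(1)` with its usual smooth structure, as a submanifold of `ℂ`. -/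
instance : DiffeologicalSpace Circle :=
  letI := NormedSpace.toDiffeology ℂ
  inducedDiffeology (fun z : Circle => (z : ℂ))

/-- `pr : P → X` is a smooth principal `U(1)`-bundle: a smooth action of `U(1)` on `P` which over
a neighbourhood of every point of `X` is isomorphic to the trivial one. -/
structure IsCircleBundle {P X : Type*} [DiffeologicalSpace P] [DiffeologicalSpace X]
    [MulAction Circle P] (pr : P → X) : Prop where
  smooth_proj : DSmooth pr
  smooth_smul : DSmooth (fun a : Circle × P => a.1 • a.2)
  proj_smul : ∀ (g : Circle) (e : P), pr (g • e) = pr e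
  locally_trivial : ∀ x : X, ∃ W : Set X, IsOpen[dTopology] W ∧ x ∈ W ∧
    ∃ t : W × Circle ≃ {e : P // pr e ∈ W}, DSmooth t ∧ DSmooth t.symm ∧
      (∀ a, pr (t a).1 = a.1) ∧
      ∀ (w : W) (g h : Circle), (t (w, g * h)).1 = g • (t (w, h)).1

/-- `Φ` is an isomorphism of the `U(1)`-bundles `pr₁` and `pr₂` over `X`. -/
structure IsCircleBundleIso {P₁ P₂ X : Type*} [DiffeologicalSpace P₁] [DiffeologicalSpace P₂]
    [MulAction Circle P₁] [MulAction Circle P₂] (pr₁ : P₁ → X) (pr₂ : P₂ → X) (Φ : P₁ ≃ P₂) :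
    Prop where
  smooth : DSmooth Φ
  smooth_symm : DSmooth Φ.symm
  proj : ∀ e, pr₂ (Φ e) = pr₁ e
  map_smul : ∀ (g : Circle) (e : P₁), Φ (g • e) = g • Φ e

/-- A candidate for a real 1-form on `P`: for every smooth family `c : ℝᵏ → P`, parameter `u` and
direction `v`, the value of the form on the velocity of `c` at `u` in the direction `v`. -/
abbrev PreForm (P : Type*) : Type _ := ∀ ⦃k : ℕ⦄, (Eu k → P) → Eu k → Eu k → ℝ

/-- Pull-back of a 1-form along a map. -/
def PreForm.pullback {P Q : Type*} (f : P → Q) (θ : PreForm Q) : PreForm P :=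
  fun _ c u v => θ (f ∘ c) u v

/-- `θ` is a smooth differential 1-form on the diffeological space `P`. -/
structure IsOneForm {P : Type*} [DiffeologicalSpace P] (θ : PreForm P) : Prop where
  linear : ∀ ⦃k : ℕ⦄ (c : Eu k → P), IsPlot c → ∀ u, IsLinearMap ℝ (θ c u)
  smooth : ∀ ⦃k : ℕ⦄ (c : Eu k → P), IsPlot c → ∀ v, ContDiff ℝ ∞ fun u => θ c u v
  natural : ∀ ⦃k m : ℕ⦄ (c : Eu k → P) (f : Eu m → Eu k), IsPlot c → ContDiff ℝ ∞ f →
    ∀ u v, θ (c ∘ f) u v = θ c (f u) (fderiv ℝ f u v)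

/-- `i θ` is a connection form on the `U(1)`-bundle `P`: under a variable gauge transformation
`γ` it changes by `γ⁻¹ dγ`. (For constant `γ` this is invariance, for a constant family in `P` it
says that `i θ` reproduces the generators of the action.) -/
structure IsCircleConnection {P : Type*} [DiffeologicalSpace P] [MulAction Circle P]
    (θ : PreForm P) : Prop extends IsOneForm θ where
  gauge : ∀ ⦃k : ℕ⦄ (c : Eu k → P) (γ : Eu k → Circle), IsPlot c → IsPlot γ → ∀ u v,
    θ (fun y => γ y • c y) u v =
      θ c u v + (star (γ u : ℂ) * fderiv ℝ (fun y => (γ y : ℂ)) u v).im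

/-- The exterior derivative of a 1-form, evaluated along a smooth family; for a connection form
`i θ` on a `U(1)`-bundle the curvature is `i dθ`. -/
def PreForm.d {P : Type*} (θ : PreForm P) ⦃k : ℕ⦄ (c : Eu k → P) (u v w : Eu k) : ℝ :=
  fderiv ℝ (fun y => θ c y w) u v - fderiv ℝ (fun y => θ c y v) u w

end SBS

/-! ## Symplectic manifolds and prequantization -/

namespace SBS

universe u v

section Symplectic

variable {n : ℕ} {M : Type u} [TopologicalSpace M] [ChartedSpace (Eu (2 * n)) M]

variable (n M) in
/-- Differential 2-forms on the `2n`-dimensional manifold `M`, not necessarily smooth. -/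
abbrev TwoForm : Type u :=
  (x : M) → (TangentSpace (𝓡 (2 * n)) x) [⋀^Fin 2]→L[ℝ] ℝ

/-- The coordinate expression of a 2-form in the preferred chart at `x₀`. -/
def chartForm (Ω : TwoForm n M) (x₀ : M) (y : Eu (2 * n)) : (Eu (2 * n)) [⋀^Fin 2]→L[ℝ] ℝ :=
  (Ω ((extChartAt (𝓡 (2 * n)) x₀).symm y)).compContinuousLinearMap
    (mfderiv 𝓘(ℝ, Eu (2 * n)) (𝓡 (2 * n)) (extChartAt (𝓡 (2 * n)) x₀).symm y)

/-- `Ω` is a symplectic form. -/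
structure IsSymplectic (Ω : TwoForm n M) : Prop where
  smooth : ∀ x₀ : M, ContDiffOn ℝ ∞ (chartForm Ω x₀) (extChartAt (𝓡 (2 * n)) x₀).target
  closed : ∀ x₀ : M, ∀ y ∈ (extChartAt (𝓡 (2 * n)) x₀).target, extDeriv (chartForm Ω x₀) y = 0
  nondegenerate : ∀ (x : M) (v : TangentSpace (𝓡 (2 * n)) x),
    (∀ w : TangentSpace (𝓡 (2 * n)) x, Ω x ![v, w] = 0) → v = 0

variable [MeasurableSpace M]

/-- The measure of `Ωⁿ / n!` on the domain of the chart at `x₀`: in coordinates `Ωⁿ / n!` is the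
Pfaffian of the matrix of `Ω`, whose absolute value is `√|det|`. -/
def chartVolume (Ω : TwoForm n M) (x₀ : M) : Measure M :=
  ((volume.restrict (extChartAt (𝓡 (2 * n)) x₀).target).withDensity fun y =>
    ENNReal.ofReal √|(Matrix.of fun i j : Fin (2 * n) =>
      chartForm Ω x₀ y ![EuclideanSpace.single i 1, EuclideanSpace.single j 1]).det|).map
    (extChartAt (𝓡 (2 * n)) x₀).symm

/-- The Liouville measure, i.e. integration of `Ωⁿ / n!`, glued from the charts by a smooth
partition of unity (the result does not depend on it). -/
def liouville [IsManifold (𝓡 (2 * n)) ∞ M] [T2Space M] [SigmaCompactSpace M] (Ω : TwoForm n M) :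
    Measure M :=
  Measure.sum fun i : M => (chartVolume Ω i).withDensity fun x =>
    ENNReal.ofReal
      ((SmoothPartitionOfUnity.exists_isSubordinate_chartAt_source (𝓡 (2 * n)) M).choose i x)

end Symplectic

section Homology

open CategoryTheory AlgebraicTopology

/-- Singular homology `H_n(X, ℤ)`. -/
abbrev Homology (n : ℕ) (X : Type u) [TopologicalSpace X] : ModuleCat.{u} ℤ :=
  ((singularHomologyFunctor (ModuleCat.{u} ℤ) n).obj (ModuleCat.of ℤ (ULift.{u} ℤ))).obj
    (TopCat.of X)

/-- The map `f_* : H_n(X, ℤ) → H_n(Y, ℤ)`. -/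
def Homology.map (n : ℕ) {X Y : Type u} [TopologicalSpace X] [TopologicalSpace Y] (f : C(X, Y)) :
    Homology n X → Homology n Y :=
  (((singularHomologyFunctor (ModuleCat.{u} ℤ) n).obj (ModuleCat.of ℤ (ULift.{u} ℤ))).map
    (TopCat.ofHom f)).hom

/-- `o` is a fundamental class of a closed connected `n`-manifold: it generates `H_n ≅ ℤ`. (Its
existence means that the manifold is orientable; its choice is an orientation.) -/
def IsFundamentalClass {n : ℕ} {X : Type u} [TopologicalSpace X] (o : Homology n X) : Prop :=
  ∃ e : Homology n X ≃ₗ[ℤ] ℤ, e o = 1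

end Homology

section LineBundle

/-! ### Hermitian line bundles, their sections and connections

`L` is a smooth complex line bundle over `M`, with a Hermitian inner product on each fibre. -/

variable (n : ℕ) {M : Type u} [TopologicalSpace M] [ChartedSpace (Eu (2 * n)) M]
  (L : M → Type v) [TopologicalSpace (TotalSpace ℂ L)]
  [∀ x, NormedAddCommGroup (L x)] [∀ x, InnerProductSpace ℂ (L x)] [FiberBundle ℂ L]
  [VectorBundle ℂ ℂ L] [VectorBundle ℝ ℂ L]
  [IsManifold (𝓡 (2 * n)) ∞ M] [ContMDiffVectorBundle ∞ ℂ L (𝓡 (2 * n))]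

/-- `Γ(M, L)`: the complex vector space of smooth sections of `L`. -/
def SmoothSections : Submodule ℂ (∀ x, L x) where
  carrier := {s | ContMDiff (𝓡 (2 * n)) ((𝓡 (2 * n)).prod 𝓘(ℝ, ℂ)) ∞
    fun x => TotalSpace.mk' ℂ x (s x)}
  zero_mem' := Bundle.contMDiff_zeroSection ℝ L
  add_mem' := fun {s t} hs ht => ContMDiff.add_section hs ht
  smul_mem' := fun c s hs x₀ => by
    rw [Bundle.contMDiffAt_section]
    have h := (Bundle.contMDiffAt_section (IB := 𝓡 (2 * n)) (n := ∞) x₀).1 (hs x₀)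
    have h' : ContMDiffAt (𝓡 (2 * n)) 𝓘(ℝ, ℂ) ∞
        (fun x => c • (trivializationAt ℂ L x₀ ⟨x, s x⟩).2) x₀ :=
      (contDiff_const_smul c).contDiffAt.contMDiffAt.comp x₀ h
    refine h'.congr_of_eventuallyEq ?_
    filter_upwards [(trivializationAt ℂ L x₀).open_baseSet.mem_nhds
      (FiberBundle.mem_baseSet_trivializationAt' x₀)] with x hx
    exact ((trivializationAt ℂ L x₀).linear ℂ hx).map_smul c (s x)

/-- The fibrewise Hermitian inner products depend smoothly on the point. -/
def IsSmoothHermitian : Prop :=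
  ∀ s ∈ SmoothSections n L, ∀ t ∈ SmoothSections n L,
    ContMDiff (𝓡 (2 * n)) 𝓘(ℝ, ℂ) ∞ fun x => ⟪s x, t x⟫_ℂ

/-- The Hermitian connections `𝒜_h(L)`: smooth, complex linear and metric covariant derivatives.
Here `a s x v` is `(∇_v s)(x)`. -/
structure HermitianConnection extends CovariantDerivative (𝓡 (2 * n)) ℂ L where
  smooth : CovariantDerivative.ContMDiffCovariantDerivative toCovariantDerivative ∞
  complex_smul : ∀ s ∈ SmoothSections n L, ∀ (c : ℂ) (x : M) (v : TangentSpace (𝓡 (2 * n)) x),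
    toFun (c • s) x v = c • toFun s x v
  metric : ∀ s ∈ SmoothSections n L, ∀ t ∈ SmoothSections n L,
    ∀ (x : M) (v : TangentSpace (𝓡 (2 * n)) x),
      mvfderiv (𝓡 (2 * n)) (fun y => ⟪s y, t y⟫_ℂ) x v =
        ⟪toFun s x v, t x⟫_ℂ + ⟪s x, toFun t x v⟫_ℂ

variable {n L}

/-- `a ∈ 𝒪(Ω)`: the curvature `F_a(X, Y) = ∇_X ∇_Y - ∇_Y ∇_X - ∇_[X, Y]` is `2πi Ω(X, Y)`. -/
def HermitianConnection.IsPrequantum (a : HermitianConnection n L) (Ω : TwoForm n M) : Prop :=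
  ∀ X Y : (x : M) → TangentSpace (𝓡 (2 * n)) x,
    ContMDiff (𝓡 (2 * n)) (𝓡 (2 * n)).tangent ∞ (fun x => (⟨x, X x⟩ : TangentBundle (𝓡 (2 * n)) M)) →
    ContMDiff (𝓡 (2 * n)) (𝓡 (2 * n)).tangent ∞ (fun x => (⟨x, Y x⟩ : TangentBundle (𝓡 (2 * n)) M)) →
    ∀ s ∈ SmoothSections n L, ∀ x : M,
      a.toFun (fun y => a.toFun s y (Y y)) x (X x) - a.toFun (fun y => a.toFun s y (X y)) x (Y x)
        - a.toFun s x (VectorField.mlieBracket (𝓡 (2 * n)) X Y x) =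
      (2 * Real.pi * Complex.I * Ω x ![X x, Y x]) • s x

/-! ### The projective space of sections and the bundle `𝒪(1)` -/

section Projective

variable (n L)

/-- `ℙΓ(M, L)`. -/
abbrev ProjSections : Type _ := ℙ ℂ (SmoothSections n L)

variable {n L}

/-- The family `α_u` of sections is smooth, jointly in `u` and the point of `M`, for `u` near
`u₀`. -/
def IsSmoothFamily ⦃k : ℕ⦄ (α : Eu k → SmoothSections n L) (u₀ : Eu k) : Prop :=
  ∃ W ∈ 𝓝 u₀, ContMDiffOn (𝓘(ℝ, Eu k).prod (𝓡 (2 * n))) ((𝓡 (2 * n)).prod 𝓘(ℝ, ℂ)) ∞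
    (fun z : Eu k × M => TotalSpace.mk' ℂ z.2 ((α z.1).1 z.2)) (W ×ˢ Set.univ)

/-- Near `u₀`, the family `p_u` of points of `ℙΓ(M, L)` is represented by the smooth family of
non-zero sections `α_u`. -/
def IsLift ⦃k : ℕ⦄ (p : Eu k → ProjSections n L) (α : Eu k → SmoothSections n L) (u₀ : Eu k) :
    Prop :=
  IsSmoothFamily α u₀ ∧ ∀ᶠ y in 𝓝 u₀, ∃ h : α y ≠ 0, p y = Projectivization.mk ℂ (α y) h

/-- The `L²` inner product of sections, linear in the second variable. -/
def l2 [MeasurableSpace M] (μ : Measure M) (s t : ∀ x, L x) : ℂ := ∫ x, ⟪s x, t x⟫_ℂ ∂μ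

lemma exists_isSmoothFamily_const (α : SmoothSections n L) ⦃k : ℕ⦄ (u₀ : Eu k) :
    IsSmoothFamily (fun _ : Eu k => α) u₀ :=
  ⟨Set.univ, Filter.univ_mem, (ContMDiff.comp α.2 contMDiff_snd).contMDiffOn⟩

lemma IsSmoothFamily.comp {k m : ℕ} {α : Eu k → SmoothSections n L} {f : Eu m → Eu k}
    {v : Set (Eu m)} {u : Eu m} (hv : IsOpen v) (hu : u ∈ v) (hf : ContDiffOn ℝ ∞ f v)
    (h : IsSmoothFamily α (f u)) : IsSmoothFamily (α ∘ f) u := by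
  obtain ⟨W, hW, H⟩ := h
  have hc : ContinuousAt f u := hf.continuousOn.continuousAt (hv.mem_nhds hu)
  refine ⟨v ∩ f ⁻¹' W, Filter.inter_mem (hv.mem_nhds hu) (hc hW), ?_⟩
  have hg : ContMDiffOn (𝓘(ℝ, Eu m).prod (𝓡 (2 * n))) (𝓘(ℝ, Eu k).prod (𝓡 (2 * n))) ∞
      (fun z : Eu m × M => (f z.1, z.2)) ((v ∩ f ⁻¹' W) ×ˢ Set.univ) :=
    ((hf.contMDiffOn.mono Set.inter_subset_left).comp contMDiffOn_fst fun z hz => hz.1).prodMk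
      contMDiffOn_snd
  exact H.comp hg fun z hz => ⟨hz.1.2, trivial⟩

/-- The smooth structure of `ℙΓ(M, L)`: a family of points is smooth if locally it is represented
by a smooth family of non-zero sections. -/
instance : DiffeologicalSpace (ProjSections n L) :=
  diffeologyOfLocal (fun _ p u => ∃ α, IsLift p α u)
    (by
      rintro k p q u h ⟨α, hα, H⟩
      refine ⟨α, hα, ?_⟩
      filter_upwards [h, H] with y hy ⟨h0, hm⟩
      exact ⟨h0, hy ▸ hm⟩)
    (fun k x u => ⟨fun _ => x.rep, exists_isSmoothFamily_const _ _,
      Filter.Eventually.of_forall fun _ => ⟨x.rep_nonzero, x.mk_rep.symm⟩⟩)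
    (by
      rintro k m p f v u hv hu hf ⟨α, hα, H⟩
      exact ⟨α ∘ f, hα.comp hv hu hf,
        (hf.continuousOn.continuousAt (hv.mem_nhds hu)).eventually H⟩)

variable [MeasurableSpace M]

/-- The value of the Fubini-Study form of `ℙΓ(M, L)` at `[α]` on the tangent vectors represented
by `v` and `w`. It is normalised to be a generator of the integral cohomology of a projective
line. -/
def fubiniStudy (μ : Measure M) (α v w : ∀ x, L x) : ℝ :=
  1 / Real.pi * (l2 μ v w / l2 μ α α - l2 μ v α * l2 μ α w / l2 μ α α ^ 2).im

variable (n L) in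
/-- The total space of the `U(1)`-bundle `𝒪(1)` over `ℙΓ(M, L)`: pairs of a line `p` in `Γ(M, L)`
and a linear functional `ξ` on `p` of norm one, i.e. such that `ξ s = 1` for a unit vector `s`. -/
def O1 (μ : Measure M) : Type _ :=
  Σ p : ProjSections n L,
    {ξ : Module.Dual ℂ p.submodule // ∃ s : p.submodule, ξ s = 1 ∧ l2 μ s.1.1 s.1.1 = 1}

variable {μ : Measure M}

/-- The projection `𝒪(1) → ℙΓ(M, L)`. -/
def O1.proj (ξ : O1 n L μ) : ProjSections n L := ξ.1

/-- The unit section `s` in the line `p` with `ξ s = 1`; thus `ξ = ⟪s, ·⟫`. -/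
def O1.dualVec (ξ : O1 n L μ) : SmoothSections n L := ξ.2.2.choose.1

lemma O1.dualVec_mem (ξ : O1 n L μ) : ξ.dualVec ∈ ξ.1.submodule := ξ.2.2.choose.2

lemma O1.apply_dualVec (ξ : O1 n L μ) : ξ.2.1 ⟨ξ.dualVec, ξ.dualVec_mem⟩ = 1 :=
  ξ.2.2.choose_spec.1

/-- The action of `U(1)` on `𝒪(1)` induced by its action on `L`: `(g • ξ)(s) = ξ(g⁻¹ s)`. -/
instance : MulAction Circle (O1 n L μ) where
  smul g ξ := ⟨ξ.1, ((g⁻¹ : Circle) : ℂ) • ξ.2.1, by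
    obtain ⟨s, h1, h2⟩ := ξ.2.2
    refine ⟨(g : ℂ) • s, by simp [h1], ?_⟩
    have : ∀ x, ⟪((g : ℂ) • s).1.1 x, ((g : ℂ) • s).1.1 x⟫_ℂ = ⟪s.1.1 x, s.1.1 x⟫_ℂ := by
      intro x
      change ⟪(g : ℂ) • s.1.1 x, (g : ℂ) • s.1.1 x⟫_ℂ = _
      rw [inner_smul_left, inner_smul_right, ← mul_assoc, ← Complex.normSq_eq_conj_mul_self]
      simp
    simp only [l2] at h2 ⊢
    simp only [this]
    exact h2⟩
  one_smul ξ := Sigma.ext rfl (heq_of_eq (Subtype.ext (by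
    change (((1 : Circle)⁻¹ : Circle) : ℂ) • ξ.2.1 = ξ.2.1
    simp)))
  mul_smul g h ξ := Sigma.ext rfl (heq_of_eq (Subtype.ext (by
    change (((g * h)⁻¹ : Circle) : ℂ) • ξ.2.1 =
      ((g⁻¹ : Circle) : ℂ) • ((h⁻¹ : Circle) : ℂ) • ξ.2.1
    rw [smul_smul, mul_inv, Circle.coe_mul])))

/-- The smooth structure of `𝒪(1)`: a family of unit functionals is smooth if locally it is dual to
a smooth family of (unit) sections. -/
instance : DiffeologicalSpace (O1 n L μ) :=
  diffeologyOfLocal (fun k ξ u => ∃ α : Eu k → SmoothSections n L, IsSmoothFamily α u ∧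
      ∀ᶠ y in 𝓝 u, ∃ h : α y ∈ (ξ y).1.submodule, (ξ y).2.1 ⟨α y, h⟩ = 1)
    (by
      rintro k p q u h ⟨α, hα, H⟩
      refine ⟨α, hα, ?_⟩
      filter_upwards [h, H] with y hy hm
      exact hy ▸ hm)
    (fun k ξ u => ⟨fun _ => ξ.dualVec, exists_isSmoothFamily_const _ _,
      Filter.Eventually.of_forall fun _ => ⟨ξ.dualVec_mem, ξ.apply_dualVec⟩⟩)
    (by
      rintro k m p f v u hv hu hf ⟨α, hα, H⟩
      exact ⟨α ∘ f, hα.comp hv hu hf,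
        (hf.continuousOn.continuousAt (hv.mem_nhds hu)).eventually H⟩)

variable (n L μ) in
/-- The Hermitian connection `A` of `𝒪(1)`, as a real connection form: along a family of unit
functionals dual to unit sections `s_u` it is `Im ⟪s, ds⟫`, so that a family is horizontal when
`ds` is orthogonal to `s`. -/
def chernForm : PreForm (O1 n L μ) := fun _ ξ u v =>
  (l2 μ (ξ u).dualVec.1 fun x => fderiv ℝ (fun y => (ξ y).dualVec.1 x) u v).im

end Projective

/-! ### Bohr-Sommerfeld Lagrangian submanifolds and Planckian cycles

Submanifolds are embedded images of a fixed manifold `S₀`. -/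

section BohrSommerfeld

variable (S₀ : Type u) [TopologicalSpace S₀] [ChartedSpace (Eu n) S₀]

/-- The section `σ` of `L|_S` is covariantly constant for the restriction of `a` to `S`: it is the
restriction of a section of `L` whose covariant derivatives in the directions tangent to `S`
vanish. -/
def IsCovConst (a : HermitianConnection n L) (S : Set M) (σ : (x : S) → L x) : Prop :=
  ∃ s ∈ SmoothSections n L, (∀ x : S, s x = σ x) ∧
    ∀ f : S₀ → M, IsSmoothEmbedding (𝓡 n) (𝓡 (2 * n)) ∞ f → Set.range f = S →
      ∀ (q : S₀) (v : TangentSpace (𝓡 n) q),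
        a.toFun s (f q) (mfderiv (𝓡 n) (𝓡 (2 * n)) f q v) = 0

variable {S₀}

lemma IsCovConst.smul {a : HermitianConnection n L} {S : Set M} {σ : (x : S) → L x}
    (h : IsCovConst S₀ a S σ) (c : ℂ) : IsCovConst S₀ a S (c • σ) := by
  obtain ⟨s, hs, h1, h2⟩ := h
  refine ⟨c • s, (SmoothSections n L).smul_mem c hs, fun x => ?_, fun f hf hr q v => ?_⟩
  · simp [h1]
  · rw [a.complex_smul s hs, h2 f hf hr, smul_zero]

/-- `S` is a Bohr-Sommerfeld Lagrangian submanifold of `M` of the topological type of `S₀` (whose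
fundamental class is `o`) and of the homology class `c`. -/
structure IsBohrSommerfeld (Ω : TwoForm n M) (a : HermitianConnection n L) (o : Homology n S₀)
    (c : Homology n M) (S : Set M) : Prop where
  exists_param : ∃ f : C(S₀, M), IsSmoothEmbedding (𝓡 n) (𝓡 (2 * n)) ∞ f ∧ Set.range f = S ∧
    (∀ (q : S₀) (v w : TangentSpace (𝓡 n) q),
      Ω (f q) ![mfderiv (𝓡 n) (𝓡 (2 * n)) f q v, mfderiv (𝓡 n) (𝓡 (2 * n)) f q w] = 0) ∧
    Homology.map n f o = c
  exists_covConst : ∃ σ : (x : S) → L x, IsCovConst S₀ a S σ ∧ ∀ x, σ x ≠ 0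

/-- The moduli space `ℬ_S` of Bohr-Sommerfeld Lagrangian submanifolds. -/
def BS (Ω : TwoForm n M) (a : HermitianConnection n L) (o : Homology n S₀) (c : Homology n M) :
    Type u :=
  {S : Set M // IsBohrSommerfeld Ω a o c S}

variable {Ω : TwoForm n M} {a : HermitianConnection n L} {o : Homology n S₀} {c : Homology n M}

/-- Near `u₀` the family `S_u` of submanifolds is smoothly parametrized by the embeddings
`f_u : S₀ → M`. -/
def IsParam ⦃k : ℕ⦄ (S : Eu k → BS Ω a o c) (f : Eu k → S₀ → M) (u₀ : Eu k) : Prop :=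
  ∃ W ∈ 𝓝 u₀, ContMDiffOn (𝓘(ℝ, Eu k).prod (𝓡 n)) (𝓡 (2 * n)) ∞
      (fun z : Eu k × S₀ => f z.1 z.2) (W ×ˢ Set.univ) ∧
    ∀ y ∈ W, IsSmoothEmbedding (𝓡 n) (𝓡 (2 * n)) ∞ (f y) ∧ Set.range (f y) = (S y).1

/-- The smooth structure of `ℬ_S`: a family of submanifolds is smooth if locally it is
parametrized by a smooth family of embeddings. -/
instance : DiffeologicalSpace (BS Ω a o c) :=
  diffeologyOfLocal (fun _ S u => ∃ f, IsParam S f u)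
    (by
      rintro k S T u h ⟨f, W, hW, hf, H⟩
      refine ⟨f, W ∩ {y | S y = T y}, Filter.inter_mem hW h,
        hf.mono (Set.prod_mono_left Set.inter_subset_left), fun y hy => ?_⟩
      rw [← show S y = T y from hy.2]
      exact H y hy.1)
    (fun k S u => by
      obtain ⟨f, hf, hr, -⟩ := S.2.exists_param
      exact ⟨fun _ => f, Set.univ, Filter.univ_mem,
        (hf.contMDiff.comp contMDiff_snd).contMDiffOn, fun _ _ => ⟨hf, hr⟩⟩)
    (by
      rintro k m S g v u hv hu hg ⟨f, W, hW, hf, H⟩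
      have hc : ContinuousAt g u := hg.continuousOn.continuousAt (hv.mem_nhds hu)
      refine ⟨f ∘ g, v ∩ g ⁻¹' W, Filter.inter_mem (hv.mem_nhds hu) (hc hW), ?_,
        fun y hy => H (g y) hy.2⟩
      have hg' : ContMDiffOn (𝓘(ℝ, Eu m).prod (𝓡 n)) (𝓘(ℝ, Eu k).prod (𝓡 n)) ∞
          (fun z : Eu m × S₀ => (g z.1, z.2)) ((v ∩ g ⁻¹' W) ×ˢ Set.univ) :=
        ((hg.contMDiffOn.mono Set.inter_subset_left).comp contMDiffOn_fst
          fun z hz => hz.1).prodMk contMDiffOn_snd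
      exact hf.comp hg' fun z hz => ⟨hz.1.2, trivial⟩)

variable (Ω a o c) in
/-- The total space of the `U(1)`-bundle `𝒫_S(a)` of Planckian cycles: pairs of `S` in `ℬ_S` and a
covariantly constant lift of `S` to the unit circle bundle of `L`. -/
def Planck : Type _ :=
  Σ S : BS Ω a o c, {σ : (x : S.1) → L x // IsCovConst S₀ a S.1 σ ∧ ∀ x, ‖σ x‖ = 1}

/-- The projection `𝒫_S(a) → ℬ_S`. -/
def Planck.proj (σ : Planck Ω a o c) : BS Ω a o c := σ.1

/-- The action of `U(1)` on `𝒫_S(a)` induced by its action on `L`. -/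
instance : MulAction Circle (Planck Ω a o c) where
  smul g σ := ⟨σ.1, (g : ℂ) • σ.2.1, σ.2.2.1.smul _, fun x => by
    change ‖(g : ℂ) • σ.2.1 x‖ = 1
    rw [norm_smul, σ.2.2.2 x, Circle.norm_coe, one_mul]⟩
  one_smul σ := Sigma.ext rfl (heq_of_eq (Subtype.ext (by
    change ((1 : Circle) : ℂ) • σ.2.1 = σ.2.1
    simp)))
  mul_smul g h σ := Sigma.ext rfl (heq_of_eq (Subtype.ext (by
    change ((g * h : Circle) : ℂ) • σ.2.1 = (g : ℂ) • (h : ℂ) • σ.2.1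
    rw [smul_smul, Circle.coe_mul])))

/-- The Planckian cycle `σ` in the total space of `L` is parametrized by `τ`, which covers an
embedding of `S₀`. -/
def Planck.IsParamBy (σ : Planck Ω a o c) (τ : S₀ → TotalSpace ℂ L) : Prop :=
  IsSmoothEmbedding (𝓡 n) (𝓡 (2 * n)) ∞ (fun q => (τ q).proj) ∧
    Set.range (fun q => (τ q).proj) = σ.1.1 ∧
    ∀ (q : S₀) (h : (τ q).proj ∈ σ.1.1), (τ q).snd = σ.2.1 ⟨(τ q).proj, h⟩

/-- The smooth structure of `𝒫_S(a)`: a family of Planckian cycles is smooth if locally it is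
parametrized by a smooth family of maps to the total space of `L`. -/
instance : DiffeologicalSpace (Planck Ω a o c) :=
  diffeologyOfLocal (fun k σ u => ∃ τ : Eu k → S₀ → TotalSpace ℂ L, ∃ W ∈ 𝓝 u,
      ContMDiffOn (𝓘(ℝ, Eu k).prod (𝓡 n)) ((𝓡 (2 * n)).prod 𝓘(ℝ, ℂ)) ∞
        (fun z : Eu k × S₀ => τ z.1 z.2) (W ×ˢ Set.univ) ∧
      ∀ y ∈ W, (σ y).IsParamBy (τ y))
    (by
      rintro k S T u h ⟨f, W, hW, hf, H⟩
      refine ⟨f, W ∩ {y | S y = T y}, Filter.inter_mem hW h,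
        hf.mono (Set.prod_mono_left Set.inter_subset_left), fun y hy => ?_⟩
      rw [← show S y = T y from hy.2]
      exact H y hy.1)
    (fun k σ u => by
      obtain ⟨f, hf, hr, -⟩ := σ.1.2.exists_param
      obtain ⟨s, hs, h1, -⟩ := σ.2.2.1
      refine ⟨fun _ q => ⟨f q, s (f q)⟩, Set.univ, Filter.univ_mem,
        ((ContMDiff.comp hs hf.contMDiff).comp contMDiff_snd).contMDiffOn,
        fun _ _ => ⟨hf, hr, fun q h => h1 ⟨f q, h⟩⟩⟩)
    (by
      rintro k m S g v u hv hu hg ⟨f, W, hW, hf, H⟩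
      have hc : ContinuousAt g u := hg.continuousOn.continuousAt (hv.mem_nhds hu)
      refine ⟨f ∘ g, v ∩ g ⁻¹' W, Filter.inter_mem (hv.mem_nhds hu) (hc hW), ?_,
        fun y hy => H (g y) hy.2⟩
      have hg' : ContMDiffOn (𝓘(ℝ, Eu m).prod (𝓡 n)) (𝓘(ℝ, Eu k).prod (𝓡 n)) ∞
          (fun z : Eu m × S₀ => (g z.1, z.2)) ((v ∩ g ⁻¹' W) ×ˢ Set.univ) :=
        ((hg.contMDiffOn.mono Set.inter_subset_left).comp contMDiffOn_fst
          fun z hz => hz.1).prodMk contMDiffOn_snd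
      exact hf.comp hg' fun z hz => ⟨hz.1.2, trivial⟩)

/-! ### The universal special Bohr-Sommerfeld set and its `U(1)`-bundles -/

variable (Ω a o c) in
/-- `𝒰_SBS(a)`: pairs `([α], S)` such that `α|_S = e^{iθ} F σ_S` for a covariantly constant
`σ_S`, a real constant `θ` and a smooth strictly positive function `F` on `S`. -/
def USBS : Set (ProjSections n L × BS Ω a o c) :=
  {x | ∃ (α : SmoothSections n L) (h : α ≠ 0), x.1 = Projectivization.mk ℂ α h ∧
    ∃ σ : (y : x.2.1) → L y, IsCovConst S₀ a x.2.1 σ ∧ (∀ y, σ y ≠ 0) ∧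
      ∃ (θ : ℝ) (F : M → ℝ), ContMDiff (𝓡 (2 * n)) 𝓘(ℝ, ℝ) ∞ F ∧
        ∀ y : x.2.1, 0 < F y ∧ α.1 y = (Complex.exp (θ * Complex.I) * F y) • σ y}

variable [MeasurableSpace M] {μ : Measure M}

variable (μ) in
/-- The bundle `p₁^* 𝒪(1)` restricted to `V`. -/
def O1Over (V : Set (ProjSections n L × BS Ω a o c)) : Type _ :=
  {e : V × O1 n L μ // e.2.proj = e.1.1.1}

/-- The bundle `p₂^* 𝒫_S(a)` restricted to `V`. -/
def PlanckOver (V : Set (ProjSections n L × BS Ω a o c)) : Type _ :=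
  {e : V × Planck Ω a o c // e.2.proj = e.1.1.2}

variable {V : Set (ProjSections n L × BS Ω a o c)}

instance : DiffeologicalSpace (O1Over μ V) :=
  inferInstanceAs (DiffeologicalSpace {e : V × O1 n L μ // e.2.proj = e.1.1.1})

instance : DiffeologicalSpace (PlanckOver V) :=
  inferInstanceAs (DiffeologicalSpace {e : V × Planck Ω a o c // e.2.proj = e.1.1.2})

instance : MulAction Circle (O1Over μ V) where
  smul g e := ⟨(e.1.1, g • e.1.2), e.2⟩
  one_smul e := Subtype.ext (Prod.ext rfl (one_smul Circle e.1.2))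
  mul_smul g h e := Subtype.ext (Prod.ext rfl (mul_smul g h e.1.2))

instance : MulAction Circle (PlanckOver V) where
  smul g e := ⟨(e.1.1, g • e.1.2), e.2⟩
  one_smul e := Subtype.ext (Prod.ext rfl (one_smul Circle e.1.2))
  mul_smul g h e := Subtype.ext (Prod.ext rfl (mul_smul g h e.1.2))

/-- The projection `p₁^* 𝒪(1)|_V → V`. -/
def O1Over.proj (e : O1Over μ V) : V := e.1.1

/-- The projection `p₂^* 𝒫_S(a)|_V → V`. -/
def PlanckOver.proj (e : PlanckOver V) : V := e.1.1

/-- The natural pairing of the section `s^*` of the dual of `L`, pointwise dual to the section `s`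
corresponding to `ξ`, with the Planckian cycle `σ`, is real and strictly positive along `S`. -/
def PosPairing (ξ : O1 n L μ) (σ : Planck Ω a o c) : Prop :=
  ∃ s : ξ.1.submodule, ξ.2.1 s = 1 ∧
    ∀ x : σ.1.1, 0 < (⟪s.1.1 x, σ.2.1 x⟫_ℂ).re ∧ (⟪s.1.1 x, σ.2.1 x⟫_ℂ).im = 0

lemma PosPairing.smul {ξ : O1 n L μ} {σ : Planck Ω a o c} (h : PosPairing ξ σ) (g : Circle) :
    PosPairing (g • ξ) (g • σ) := by
  obtain ⟨s, h1, h2⟩ := h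
  refine ⟨(g : ℂ) • s, ?_, fun x => ?_⟩
  · change ((g⁻¹ : Circle) : ℂ) • ξ.2.1 ((g : ℂ) • s) = 1
    simp [h1]
  · have : ⟪(g : ℂ) • s.1.1 x, (g : ℂ) • σ.2.1 x⟫_ℂ = ⟪s.1.1 x, σ.2.1 x⟫_ℂ := by
      rw [inner_smul_left, inner_smul_right, ← mul_assoc, ← Complex.normSq_eq_conj_mul_self]
      simp
    change 0 < (⟪(g : ℂ) • s.1.1 x, (g : ℂ) • σ.2.1 x⟫_ℂ).re ∧
      (⟪(g : ℂ) • s.1.1 x, (g : ℂ) • σ.2.1 x⟫_ℂ).im = 0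
    rw [this]
    exact h2 x

/-- `Φ` is the canonical isomorphism `p₁^* 𝒪(1)|_V ≅ p₂^* 𝒫_S(a)|_V`: an isomorphism of
`U(1)`-bundles under which corresponding elements have positive pairing. -/
structure IsCanonicalIso (Φ : O1Over μ V ≃ PlanckOver V) : Prop extends
    IsCircleBundleIso O1Over.proj PlanckOver.proj Φ where
  pos : ∀ e, PosPairing e.1.2 (Φ e).1.2

variable (Ω a o c μ) in
/-- The `U(1)`-bundle `ℒ` over `𝒰_SBS(a)`: the diagonal in the fibre product of `p₁^* 𝒪(1)` and
`p₂^* 𝒫_S(a)` singled out by the positivity of the pairing. -/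
def UnivBundle : Type _ :=
  {e : O1Over μ (USBS Ω a o c) × PlanckOver (USBS Ω a o c) //
    e.1.proj = e.2.proj ∧ PosPairing e.1.1.2 e.2.1.2}

instance : DiffeologicalSpace (UnivBundle Ω a o c μ) :=
  inferInstanceAs (DiffeologicalSpace
    {e : O1Over μ (USBS Ω a o c) × PlanckOver (USBS Ω a o c) //
      e.1.proj = e.2.proj ∧ PosPairing e.1.1.2 e.2.1.2})

instance : MulAction Circle (UnivBundle Ω a o c μ) where
  smul g e := ⟨(g • e.1.1, g • e.1.2), e.2.1, e.2.2.smul g⟩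
  one_smul e := Subtype.ext (one_smul Circle e.1)
  mul_smul g h e := Subtype.ext (mul_smul g h e.1)

/-- The projection `ℒ → 𝒰_SBS(a)`. -/
def UnivBundle.proj (e : UnivBundle Ω a o c μ) : USBS Ω a o c := e.1.1.proj

variable (Ω a o c μ) in
/-- The connection `p₁^* A` on `ℒ`. -/
def univConnection : PreForm (UnivBundle Ω a o c μ) :=
  (chernForm n L μ).pullback fun e => e.1.1.1.2

end BohrSommerfeld
end LineBundle
end SBS

end

open SBS

universe u v

/-! Write an element of `𝒪(1)` as `ξ = ⟪s, ·⟫` with `s` a unit section. The fibres of `L` are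
complex lines, so a unit-length `σ` along `S` pairs positively with `ξ` exactly when `σ = s / |s|`
on `S` (`PosPairing.planck_apply`). Hence `ξ` and `S` determine `σ`. Conversely, two unit sections
of one line differ by a phase, and positivity at a single point of `S` forces that phase to be `1`
(`PosPairing.functional_unique`).

A partner `σ` exists exactly over `𝒰_SBS(a)`. If it exists, then `s = |s| σ` on `S`, which is the
defining condition (`mem_USBS_of_posPairing`). If `α = e^{iθ} F σ_S`, then a constant rescaling of
`σ_S` is a partner, because a covariantly constant section has constant length
(`exists_planck_of_mem_USBS`). Such sections are also unique up to a constant phase, so every `σ`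
over `S` has a partner `ξ`. Thus `ℒ` is the graph of the canonical isomorphism, positivity makes
that isomorphism unique, and no set outside `𝒰_SBS(a)` can carry one.

Smoothness in one direction is smoothness of `s / |s|` where `s ≠ 0`
(`isPlot_planck_of_posPairing`). In the other direction the phase of `s` is read off from the
pairing at one point of `S₀` (`isPlot_functional_of_posPairing`). Local sections of `ℒ` come from
requiring `⟪s, β⟫ > 0` for a fixed section `β`.

For the curvature, `d Im ⟪s, ds⟫ = 2 Im ⟪ds, ds⟫` by symmetry of second derivatives. Since `⟪s, s⟫ =
1`, the component of `ds` along `s` is imaginary and contributes nothing to the imaginary part; what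
remains is the Fubini-Study form. The analytic input is differentiation under the integral over
compact `M`, for a Liouville measure that is finite and positive on open sets. -/

namespace SBS

/-! ### Plots in subspaces, products and `U(1)`. -/

section Diffeology

variable {X Y : Type*} [DiffeologicalSpace X] [DiffeologicalSpace Y] {k : ℕ}

lemma isPlot_subtype_iff {p : X → Prop} {f : Eu k → Subtype p} :
    IsPlot f ↔ IsPlot (fun u => (f u).1) := Iff.rfl

lemma isPlot_prod_iff {f : Eu k → X × Y} :
    IsPlot f ↔ IsPlot (fun u => (f u).1) ∧ IsPlot (fun u => (f u).2) :=
  DiffeologicalSpace.isPlot_inf_iff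

lemma isPlot_circle_iff {f : Eu k → Circle} :
    IsPlot f ↔ ContDiff ℝ ∞ (fun u => (f u : ℂ)) := Iff.rfl

end Diffeology

/-! ### Differentiation under the integral sign over a compact manifold. -/

section ParametricIntegral

variable {E H X : Type*} [NormedAddCommGroup E] [NormedSpace ℝ E] [TopologicalSpace H]
  {I : ModelWithCorners ℝ E H} [TopologicalSpace X] [ChartedSpace H X] [IsManifold I ∞ X]
  {P : Type*} [NormedAddCommGroup P] [NormedSpace ℝ P]
  {G : Type*} [NormedAddCommGroup G] [NormedSpace ℝ G]

/-- Joint smoothness survives a derivative in the parameter alone, which is what allows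
differentiation under the integral to be iterated. -/
lemma contMDiffAt_partial_fderiv {F : P → X → G} {z : P × X}
    (hF : ContMDiffAt (𝓘(ℝ, P).prod I) 𝓘(ℝ, G) ∞ (fun z : P × X => F z.1 z.2) z) :
    ContMDiffAt (𝓘(ℝ, P).prod I) 𝓘(ℝ, P →L[ℝ] G) ∞
      (fun z : P × X => fderiv ℝ (fun y => F y z.2) z.1) z := by
  have h := ContMDiffAt.mfderiv (I := 𝓘(ℝ, P)) (I' := 𝓘(ℝ, G)) (J := 𝓘(ℝ, P).prod I) (m := ∞)
    (n := ∞)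
    (x₀ := z) (fun z y => F y z.2) (fun z : P × X => z.1) ?_ contMDiffAt_fst (by simp)
  · simpa only [inTangentCoordinates_model_space, mfderiv_eq_fderiv] using h
  · have : ContMDiffAt ((𝓘(ℝ, P).prod I).prod 𝓘(ℝ, P)) (𝓘(ℝ, P).prod I) ∞
        (fun q : (P × X) × P => (q.2, q.1.2)) (z, z.1) :=
      contMDiffAt_snd.prodMk (contMDiffAt_snd.comp _ contMDiffAt_fst)
    exact ContMDiffAt.comp (z, z.1) (g := fun z : P × X => F z.1 z.2) hF this

lemma differentiableAt_of_contMDiffAt_prod {F : P → X → G} {u : P} {x : X}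
    (hF : ContMDiffAt (𝓘(ℝ, P).prod I) 𝓘(ℝ, G) ∞ (fun z : P × X => F z.1 z.2) (u, x)) :
    DifferentiableAt ℝ (fun y => F y x) u := by
  have h : ContMDiffAt 𝓘(ℝ, P) 𝓘(ℝ, G) ∞ (fun y => F y x) u :=
    ContMDiffAt.comp u (g := fun z : P × X => F z.1 z.2) hF
      (contMDiffAt_id.prodMk contMDiffAt_const)
  exact h.contDiffAt.differentiableAt (by simp)

variable [CompactSpace X] [MeasurableSpace X] [BorelSpace X] (μ : Measure X) [IsFiniteMeasure μ]
  [ProperSpace P]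

/-- The dominating function is a constant: the partial derivative is continuous on the compact set
`closedBall u ε × X`, hence bounded there, and constants are integrable for a finite measure. -/
lemma hasFDerivAt_integral_of_contMDiffAt {F : P → X → G} {W : Set P} (hW : IsOpen W)
    (hF : ∀ u ∈ W, ∀ x, ContMDiffAt (𝓘(ℝ, P).prod I) 𝓘(ℝ, G) ∞ (fun z : P × X => F z.1 z.2) (u, x))
    {u : P} (hu : u ∈ W) :
    HasFDerivAt (fun u => ∫ x, F u x ∂μ) (∫ x, fderiv ℝ (fun y => F y x) u ∂μ) u := by
  obtain ⟨ε, hε, hball⟩ := Metric.nhds_basis_closedBall.mem_iff.1 (hW.mem_nhds hu)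
  have hc : ∀ u ∈ W, Continuous (F u) := fun u hu => by
    refine continuous_iff_continuousAt.2 fun x => ?_
    exact ContinuousAt.comp (g := fun z : P × X => F z.1 z.2) (f := fun x => (u, x))
      (hF u hu x).continuousAt (by fun_prop)
  have hc' : ∀ u ∈ W, ∀ x, ContinuousAt
      (fun z : P × X => fderiv ℝ (fun y => F y z.2) z.1) (u, x) := fun u hu x =>
    (contMDiffAt_partial_fderiv (hF u hu x)).continuousAt
  have hK : IsCompact (Metric.closedBall u ε ×ˢ (Set.univ : Set X)) :=
    (isCompact_closedBall u ε).prod isCompact_univ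
  obtain ⟨C, hC⟩ := hK.exists_bound_of_continuousOn
    (f := fun z : P × X => fderiv ℝ (fun y => F y z.2) z.1)
    fun z hz => (hc' z.1 (hball hz.1) z.2).continuousWithinAt
  refine hasFDerivAt_integral_of_dominated_of_fderiv_le (𝕜 := ℝ)
    (F' := fun u x => fderiv ℝ (fun y => F y x) u) (bound := fun _ => C)
    (Metric.closedBall_mem_nhds u hε) ?_ ?_ ?_ ?_ ?_ ?_
  · filter_upwards [hW.mem_nhds hu] with y hy
    exact ((hc y hy).integrable_of_hasCompactSupport (.of_compactSpace _)).aestronglyMeasurable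
  · exact (hc u hu).integrable_of_hasCompactSupport (.of_compactSpace _)
  · have : Continuous fun x => fderiv ℝ (fun y => F y x) u :=
      continuous_iff_continuousAt.2 fun x =>
        ContinuousAt.comp (g := fun z : P × X => fderiv ℝ (fun y => F y z.2) z.1)
          (f := fun x => (u, x)) (hc' u hu x) (by fun_prop)
    exact (this.integrable_of_hasCompactSupport (.of_compactSpace _)).aestronglyMeasurable
  · exact .of_forall fun x y hy => hC (y, x) ⟨hy, trivial⟩
  · exact integrable_const C
  · exact .of_forall fun x y hy =>
      (differentiableAt_of_contMDiffAt_prod (hF y (hball hy) x)).hasFDerivAt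

end ParametricIntegral

section

variable {E H X : Type*} [NormedAddCommGroup E] [NormedSpace ℝ E] [TopologicalSpace H]
  {I : ModelWithCorners ℝ E H} [TopologicalSpace X] [ChartedSpace H X] [IsManifold I ∞ X]
  {P : Type} [NormedAddCommGroup P] [NormedSpace ℝ P]
  [CompactSpace X] [MeasurableSpace X] [BorelSpace X] (μ : Measure X) [IsFiniteMeasure μ]
  [ProperSpace P]

/-- Induction on the order of differentiability. The target `G` must vary, since the derivative
takes values in `P →L[ℝ] G`; having `P` and `G` both in `Type` keeps this space in the same
universe. -/
lemma contDiffOn_integral_of_contMDiffAt {G : Type} [NormedAddCommGroup G] [NormedSpace ℝ G]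
    {F : P → X → G} {W : Set P} (hW : IsOpen W)
    (hF : ∀ u ∈ W, ∀ x,
      ContMDiffAt (𝓘(ℝ, P).prod I) 𝓘(ℝ, G) ∞ (fun z : P × X => F z.1 z.2) (u, x)) :
    ContDiffOn ℝ ∞ (fun u => ∫ x, F u x ∂μ) W := by
  refine contDiffOn_infty.2 fun m => ?_
  induction m generalizing G with
  | zero =>
    refine contDiffOn_zero.2 fun u hu => ?_
    exact (hasFDerivAt_integral_of_contMDiffAt μ hW hF hu).continuousAt.continuousWithinAt
  | succ m ih =>
    refine (contDiffOn_succ_iff_fderiv_of_isOpen hW).2 ⟨fun u hu =>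
      (hasFDerivAt_integral_of_contMDiffAt μ hW hF hu).differentiableAt.differentiableWithinAt,
      fun h => absurd h (by exact_mod_cast WithTop.natCast_ne_top (α := ℕ∞) m), ?_⟩
    refine (ih (F := fun u x => fderiv ℝ (fun y => F y x) u)
      fun u hu x => contMDiffAt_partial_fderiv (hF u hu x)).congr fun u hu => ?_
    exact (hasFDerivAt_integral_of_contMDiffAt μ hW hF hu).fderiv

end

/-! ### The Liouville measure is finite and positive on open sets. -/

section Liouville

variable {n : ℕ} {M : Type u} [TopologicalSpace M] [ChartedSpace (Eu (2 * n)) M]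

/-- The density of the Liouville measure in the chart at `x₀`. -/
noncomputable def chartDensity (Ω : TwoForm n M) (x₀ : M) (y : Eu (2 * n)) : ℝ :=
  √|(Matrix.of fun i j : Fin (2 * n) =>
      chartForm Ω x₀ y ![EuclideanSpace.single i 1, EuclideanSpace.single j 1]).det|

lemma IsSymplectic.continuousOn_chartDensity {Ω : TwoForm n M} (hΩ : IsSymplectic Ω) (x₀ : M) :
    ContinuousOn (chartDensity Ω x₀) (extChartAt (𝓡 (2 * n)) x₀).target := by
  have h := (hΩ.smooth x₀).continuousOn
  refine (ContinuousOn.abs ?_).sqrt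
  rw [continuousOn_iff_continuous_domRestrict] at h ⊢
  refine Continuous.matrix_det (continuous_matrix fun i j => ?_)
  exact ((ContinuousAlternatingMap.apply ℝ (Eu (2 * n)) ℝ _).continuous).comp h

variable [IsManifold (𝓡 (2 * n)) ∞ M]

/-- The bilinear form given by an alternating 2-form. -/
noncomputable def alternatingToBilin {V : Type*} [AddCommGroup V] [Module ℝ V] [TopologicalSpace V]
    (B : V [⋀^Fin 2]→L[ℝ] ℝ) : V →ₗ[ℝ] V →ₗ[ℝ] ℝ :=
  LinearMap.mk₂ ℝ (fun v w => B ![v, w])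
    (fun v v' w => B.vecCons_add ![w] v v') (fun c v w => B.vecCons_smul ![w] c v)
    (fun v w w' => by
      have e : ∀ x : V, Function.update ![v, 0] 1 x = ![v, x] := fun x => by
        ext i; fin_cases i <;> simp
      have h := B.map_update_add ![v, 0] 1 w w'
      rwa [e, e, e] at h)
    (fun c v w => by
      have e : ∀ x : V, Function.update ![v, 0] 1 x = ![v, x] := fun x => by
        ext i; fin_cases i <;> simp
      have h := B.map_update_smul ![v, 0] 1 c w
      rwa [e, e] at h)

/-- A vanishing determinant gives a nonzero vector in the radical of the coordinate form. The
derivative of the inverse chart is invertible, so its image is a nonzero vector in the radical of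
`Ω`, against nondegeneracy. -/
lemma IsSymplectic.chartDensity_pos {Ω : TwoForm n M} (hΩ : IsSymplectic Ω) (x₀ : M)
    {y : Eu (2 * n)} (hy : y ∈ (extChartAt (𝓡 (2 * n)) x₀).target) : 0 < chartDensity Ω x₀ y := by
  refine Real.sqrt_pos.2 (abs_pos.2 fun hdet => ?_)
  obtain ⟨v, hv0, hv⟩ := Matrix.exists_vecMul_eq_zero_iff.2 hdet
  have hinv := isInvertible_mfderivWithin_extChartAt_symm (I := 𝓡 (2 * n)) (x := x₀) hy
  rw [ModelWithCorners.range_eq_univ, mfderivWithin_univ] at hinv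
  obtain ⟨e, he⟩ := hinv
  set v' : Eu (2 * n) := WithLp.toLp 2 v with hv'
  have hb : alternatingToBilin (chartForm Ω x₀ y) v' = 0 := by
    refine (EuclideanSpace.basisFun (Fin (2 * n)) ℝ).toBasis.ext fun j => ?_
    have hs : v' = ∑ i, v i • EuclideanSpace.single i (1 : ℝ) := by
      ext j; simp [hv', Pi.single_apply]
    have := congrFun hv j
    rw [hs, map_sum]
    simpa [Matrix.vecMul, dotProduct, alternatingToBilin] using this
  have h0 : e v' = 0 := by
    refine hΩ.nondegenerate _ _ fun w => ?_
    have h1 := LinearMap.congr_fun hb (e.symm w)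
    have h2 : Ω ((extChartAt (𝓡 (2 * n)) x₀).symm y)
        (fun i => mfderiv 𝓘(ℝ, Eu (2 * n)) (𝓡 (2 * n)) (extChartAt (𝓡 (2 * n)) x₀).symm y
          ((![v', e.symm w] : Fin 2 → Eu (2 * n)) i)) = 0 := h1
    rw [← he] at h2
    rw [← h2]
    congr 1
    funext i
    fin_cases i
    · rfl
    · exact (e.apply_symm_apply w).symm
  have h1 : v' = 0 := e.injective (h0.trans (map_zero e).symm)
  exact hv0 (by simpa [hv'] using h1)

variable [T2Space M] [MeasurableSpace M] [BorelSpace M]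

/-- The inverse chart is continuous only on its target, so measurability holds only almost
everywhere, for measures carried by the target. This is enough to evaluate `Measure.map`. -/
lemma aemeasurable_extChartAt_symm (x₀ : M) {ν : Measure (Eu (2 * n))}
    (hν : ν ≪ volume.restrict (extChartAt (𝓡 (2 * n)) x₀).target) :
    AEMeasurable (extChartAt (𝓡 (2 * n)) x₀).symm ν :=
  ((continuousOn_extChartAt_symm x₀).aemeasurable
    (isOpen_extChartAt_target x₀).measurableSet).mono_ac hν

lemma chartVolume_apply (Ω : TwoForm n M) (x₀ : M) {s : Set M} (hs : MeasurableSet s) :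
    chartVolume Ω x₀ s = ∫⁻ y in (extChartAt (𝓡 (2 * n)) x₀).symm ⁻¹' s ∩
      (extChartAt (𝓡 (2 * n)) x₀).target, ENNReal.ofReal (chartDensity Ω x₀ y) := by
  have hT := (isOpen_extChartAt_target (I := 𝓡 (2 * n)) x₀).measurableSet
  have hm := aemeasurable_extChartAt_symm (n := n) x₀ .rfl
  rw [chartVolume, Measure.map_apply_of_aemeasurable
      (aemeasurable_extChartAt_symm x₀ (withDensity_absolutelyContinuous _ _)) hs,
    withDensity_apply', Measure.restrict_restrict₀ (hm.nullMeasurable hs)]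
  · rfl

/-- In the chart, `K` becomes a compact subset of the target, on which the density is continuous and
therefore integrable. -/
lemma IsSymplectic.chartVolume_lt_top {Ω : TwoForm n M} (hΩ : IsSymplectic Ω) (x₀ : M) {K : Set M}
    (hK : IsCompact K) (hKs : K ⊆ (chartAt (Eu (2 * n)) x₀).source) :
    chartVolume Ω x₀ K < ⊤ := by
  set φ := extChartAt (𝓡 (2 * n)) x₀ with hφ
  rw [← extChartAt_source (𝓡 (2 * n))] at hKs
  have hKφ : IsCompact (φ '' K) := hK.image_of_continuousOn ((continuousOn_extChartAt x₀).mono hKs)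
  have hsub : φ '' K ⊆ φ.target := by
    rintro _ ⟨x, hx, rfl⟩
    exact φ.map_source (hKs hx)
  have heq : φ.symm ⁻¹' K ∩ φ.target = φ '' K := by
    ext y
    refine ⟨fun hy => ⟨_, hy.1, φ.right_inv hy.2⟩, ?_⟩
    rintro ⟨x, hx, rfl⟩
    exact ⟨by simpa [φ.left_inv (hKs hx)] using hx, hsub ⟨x, hx, rfl⟩⟩
  rw [chartVolume_apply _ _ hK.measurableSet, heq]
  have hint : IntegrableOn (chartDensity Ω x₀) (φ '' K) :=
    ((hΩ.continuousOn_chartDensity x₀).mono hsub).integrableOn_compact hKφ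
  exact hint.lintegral_lt_top

lemma IsSymplectic.chartVolume_pos {Ω : TwoForm n M} (hΩ : IsSymplectic Ω) (x₀ : M) {U : Set M}
    (hU : IsOpen U) (hne : (U ∩ (chartAt (Eu (2 * n)) x₀).source).Nonempty) :
    0 < chartVolume Ω x₀ U := by
  set φ := extChartAt (𝓡 (2 * n)) x₀ with hφ
  have hT := isOpen_extChartAt_target (I := 𝓡 (2 * n)) x₀
  have ho : IsOpen (φ.symm ⁻¹' U ∩ φ.target) := by
    rw [Set.inter_comm]
    exact (continuousOn_extChartAt_symm x₀).isOpen_inter_preimage hT hU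
  rw [chartVolume_apply _ _ hU.measurableSet, pos_iff_ne_zero]
  intro h0
  rw [lintegral_eq_zero_iff' (((hΩ.continuousOn_chartDensity x₀).mono
    Set.inter_subset_right).aemeasurable ho.measurableSet).ennreal_ofReal] at h0
  have h1 : ∀ᵐ y ∂(volume.restrict (φ.symm ⁻¹' U ∩ φ.target)), False := by
    filter_upwards [h0, ae_restrict_mem ho.measurableSet] with y hy hyt
    exact (hΩ.chartDensity_pos x₀ hyt.2).not_ge (by simpa using hy)
  obtain ⟨x, hx, hxs⟩ := hne
  rw [← extChartAt_source (𝓡 (2 * n))] at hxs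
  refine (ho.measure_pos volume
    ⟨φ x, by simpa [φ.left_inv hxs] using hx, φ.map_source hxs⟩).ne' ?_
  simpa [ae_iff] using h1

variable [CompactSpace M]

lemma IsSymplectic.isFiniteMeasure_liouville {Ω : TwoForm n M} (hΩ : IsSymplectic Ω) :
    IsFiniteMeasure (liouville Ω) := by
  refine ⟨?_⟩
  set ρ := (SmoothPartitionOfUnity.exists_isSubordinate_chartAt_source (𝓡 (2 * n)) M).choose
  have hρ : ρ.IsSubordinate fun x => (chartAt (Eu (2 * n)) x).source :=
    (SmoothPartitionOfUnity.exists_isSubordinate_chartAt_source (𝓡 (2 * n)) M).choose_spec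
  -- By compactness only finitely many functions of the partition are not identically zero. Each of
  -- their terms is at most the chart volume of a compact support, because `ρ i ≤ 1`.
  have hfin := ρ.locallyFinite.finite_nonempty_of_compact
  rw [liouville, Measure.sum_apply _ .univ, tsum_eq_sum (s := hfin.toFinset)]
  · refine ENNReal.sum_lt_top.2 fun i _ => ?_
    rw [withDensity_apply _ .univ, Measure.restrict_univ]
    have hK : IsCompact (tsupport (ρ i)) := (isClosed_tsupport _).isCompact
    refine lt_of_le_of_lt ?_ (hΩ.chartVolume_lt_top i hK (hρ i))
    rw [← lintegral_indicator_one hK.measurableSet]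
    refine lintegral_mono fun x => ?_
    by_cases hx : x ∈ tsupport (ρ i)
    · simpa [hx] using ρ.le_one i x
    · have h0 : ρ i x = 0 := image_eq_zero_of_notMem_tsupport hx
      change ENNReal.ofReal (ρ i x) ≤ _
      simp [h0]
  · intro i hi
    have h0 : ∀ x, ρ i x = 0 := by
      simpa [Function.support_nonempty_iff, funext_iff] using hi
    have : (fun x => ENNReal.ofReal (ρ i x)) = 0 := by ext x; simp [h0]
    change (chartVolume Ω i).withDensity (fun x => ENNReal.ofReal (ρ i x)) Set.univ = 0
    rw [this, withDensity_zero]; rfl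

lemma IsSymplectic.isOpenPosMeasure_liouville {Ω : TwoForm n M} (hΩ : IsSymplectic Ω) :
    (liouville Ω).IsOpenPosMeasure := by
  refine ⟨fun U hU ⟨x, hx⟩ => (ne_of_gt ?_)⟩
  set ρ := (SmoothPartitionOfUnity.exists_isSubordinate_chartAt_source (𝓡 (2 * n)) M).choose
  have hρ : ρ.IsSubordinate fun x => (chartAt (Eu (2 * n)) x).source :=
    (SmoothPartitionOfUnity.exists_isSubordinate_chartAt_source (𝓡 (2 * n)) M).choose_spec
  obtain ⟨i, hi⟩ := ρ.exists_pos_of_mem (Set.mem_univ x)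
  have hcont : Continuous (ρ i) := (ρ i).contMDiff.continuous
  -- One index already gives positive mass: on `V` the density `ρ i` is positive, and `V` meets the
  -- domain of chart `i` at `x`.
  set V := U ∩ {z | 0 < ρ i z} with hV
  have hVo : IsOpen V := hU.inter (isOpen_lt continuous_const hcont)
  have hxs : x ∈ (chartAt (Eu (2 * n)) i).source := hρ i (subset_tsupport _ hi.ne')
  refine lt_of_lt_of_le ?_ (measure_mono (Set.inter_subset_left : V ⊆ U))
  rw [liouville, Measure.sum_apply _ hVo.measurableSet]
  refine lt_of_lt_of_le ?_ (ENNReal.le_tsum i)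
  change 0 < (chartVolume Ω i).withDensity (fun x => ENNReal.ofReal (ρ i x)) V
  rw [withDensity_apply _ hVo.measurableSet, setLIntegral_pos_iff hcont.measurable.ennreal_ofReal]
  refine lt_of_lt_of_le (hΩ.chartVolume_pos i hVo ⟨x, ⟨hx, hi⟩, hxs⟩) (measure_mono fun y hy => ?_)
  exact ⟨by simpa using hy.2, hy⟩

end Liouville

/-! ### Smooth families of sections of `L` and their inner products. -/

section LineBundle

variable {n : ℕ} {M : Type u} [TopologicalSpace M] [ChartedSpace (Eu (2 * n)) M]
  {L : M → Type v} [TopologicalSpace (TotalSpace ℂ L)]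
  [∀ x, NormedAddCommGroup (L x)] [∀ x, InnerProductSpace ℂ (L x)] [FiberBundle ℂ L]
  [VectorBundle ℂ ℂ L] [VectorBundle ℝ ℂ L]
  [IsManifold (𝓡 (2 * n)) ∞ M] [ContMDiffVectorBundle ∞ ℂ L (𝓡 (2 * n))]

section Families

variable {EN HN N : Type*} [NormedAddCommGroup EN] [NormedSpace ℝ EN] [TopologicalSpace HN]
  {J : ModelWithCorners ℝ EN HN} [TopologicalSpace N] [ChartedSpace HN N]

lemma eventually_mem_baseSet {b : N → M} {z₀ : N} (hb : ContinuousAt b z₀) :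
    ∀ᶠ z in 𝓝 z₀, b z ∈ (trivializationAt ℂ L (b z₀)).baseSet :=
  hb.eventually ((trivializationAt ℂ L (b z₀)).open_baseSet.mem_nhds
    (FiberBundle.mem_baseSet_trivializationAt' _))

lemma contMDiffAt_mul_complex {f g : N → ℂ} {z₀ : N} (hf : ContMDiffAt J 𝓘(ℝ, ℂ) ∞ f z₀)
    (hg : ContMDiffAt J 𝓘(ℝ, ℂ) ∞ g z₀) : ContMDiffAt J 𝓘(ℝ, ℂ) ∞ (fun z => f z * g z) z₀ :=
  ContMDiffAt.comp z₀ (g := fun p : ℂ × ℂ => p.1 * p.2)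
    (contDiff_mul.contDiffAt (x := (f z₀, g z₀))).contMDiffAt (hf.prodMk_space hg)

/-- Sections along a map `b` cover both uses: `b` is the projection from parameters times `M`, or a
family of embeddings of `S₀`. -/
lemma contMDiffAt_smul_along {b : N → M} {s : ∀ z, L (b z)} {g : N → ℂ} {z₀ : N}
    (hg : ContMDiffAt J 𝓘(ℝ, ℂ) ∞ g z₀)
    (hs : ContMDiffAt J ((𝓡 (2 * n)).prod 𝓘(ℝ, ℂ)) ∞ (fun z => TotalSpace.mk' ℂ (b z) (s z)) z₀) :
    ContMDiffAt J ((𝓡 (2 * n)).prod 𝓘(ℝ, ℂ)) ∞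
      (fun z => TotalSpace.mk' ℂ (b z) (g z • s z)) z₀ := by
  rw [contMDiffAt_totalSpace] at hs ⊢
  refine ⟨hs.1, (contMDiffAt_mul_complex hg hs.2).congr_of_eventuallyEq ?_⟩
  filter_upwards [eventually_mem_baseSet (L := L) hs.1.continuousAt] with z hz
  exact ((trivializationAt ℂ L (b z₀)).linear ℂ hz).map_smul (g z) (s z)

-- Smoothness of the metric is assumed only for global sections, so a local frame is cut off by a
-- bump function to obtain a global section that is still the frame near `x₀`.
variable (n L) in
lemma exists_smoothSection_eventually_eq_one [T2Space M] (x₀ : M) :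
    ∃ e ∈ SmoothSections n L, ∀ᶠ x in 𝓝 x₀, x ∈ (trivializationAt ℂ L x₀).baseSet ∧
      (trivializationAt ℂ L x₀ ⟨x, e x⟩).2 = 1 := by
  set t := trivializationAt ℂ L x₀
  have hx₀ : x₀ ∈ t.baseSet := FiberBundle.mem_baseSet_trivializationAt' x₀
  have ht := t.open_baseSet.mem_nhds hx₀
  obtain ⟨ρ, -, hρ⟩ := (SmoothBumpFunction.nhds_basis_tsupport (I := 𝓡 (2 * n)) x₀).mem_iff.1 ht
  have hs : ContMDiffOn (𝓡 (2 * n)) ((𝓡 (2 * n)).prod 𝓘(ℝ, ℂ)) ∞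
      (fun x => TotalSpace.mk' ℂ x (t.symm x (1 : ℂ))) t.baseSet := by
    rw [t.contMDiffOn_section_baseSet_iff]
    refine contMDiffOn_const (c := (1 : ℂ)) |>.congr fun x hx => ?_
    rw [t.apply_mk_symm hx]
  refine ⟨_, ContMDiffOn.smul_section_of_tsupport ρ.contMDiff.contMDiffOn t.open_baseSet hρ hs, ?_⟩
  filter_upwards [ρ.eventuallyEq_one, ht] with x hx hxt
  refine ⟨hxt, ?_⟩
  change (t ⟨x, ρ x • t.symm x (1 : ℂ)⟩).2 = 1
  rw [hx, Pi.one_apply, one_smul, t.apply_mk_symm hxt]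

lemma eq_smul_of_trivialization {x₀ x : M} (hx : x ∈ (trivializationAt ℂ L x₀).baseSet) {e : L x}
    (he : (trivializationAt ℂ L x₀ ⟨x, e⟩).2 = 1) (v : L x) :
    v = (trivializationAt ℂ L x₀ ⟨x, v⟩).2 • e := by
  apply ((trivializationAt ℂ L x₀).continuousLinearEquivAt ℂ x hx).injective
  rw [map_smul]
  simp only [Trivialization.continuousLinearEquivAt_apply, he]
  simp

/-- The fibres of a line bundle are lines. -/
lemma exists_smul_eq_of_ne_zero {x : M} {v : L x} (hv : v ≠ 0) (w : L x) : ∃ c : ℂ, w = c • v := by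
  set φ := (trivializationAt ℂ L x).continuousLinearEquivAt ℂ x
    (FiberBundle.mem_baseSet_trivializationAt' x)
  have h0 : φ v ≠ 0 := by simpa using hv
  refine ⟨φ w / φ v, φ.injective ?_⟩
  rw [map_smul, smul_eq_mul, div_mul_cancel₀ _ h0]

/-- In terms of a global section `e` that is a frame near `b z₀`, the product is `conj(s) t ⟪e, e⟫`
with `s`, `t` the smooth coordinates, and `⟪e, e⟫` is smooth by hypothesis. -/
lemma contMDiffAt_inner_along [T2Space M] (hL : IsSmoothHermitian n L) {b : N → M}
    {s t : ∀ z, L (b z)} {z₀ : N}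
    (hs : ContMDiffAt J ((𝓡 (2 * n)).prod 𝓘(ℝ, ℂ)) ∞ (fun z => TotalSpace.mk' ℂ (b z) (s z)) z₀)
    (ht : ContMDiffAt J ((𝓡 (2 * n)).prod 𝓘(ℝ, ℂ)) ∞ (fun z => TotalSpace.mk' ℂ (b z) (t z)) z₀) :
    ContMDiffAt J 𝓘(ℝ, ℂ) ∞ (fun z => ⟪s z, t z⟫_ℂ) z₀ := by
  rw [contMDiffAt_totalSpace] at hs ht
  obtain ⟨e, he, hev⟩ := exists_smoothSection_eventually_eq_one n L (b z₀)
  have hee : ContMDiffAt J 𝓘(ℝ, ℂ) ∞ (fun z => ⟪e (b z), e (b z)⟫_ℂ) z₀ :=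
    ContMDiffAt.comp z₀ (g := fun x => ⟪e x, e x⟫_ℂ) (hL e he e he _) hs.1
  have hconj : ContMDiffAt J 𝓘(ℝ, ℂ) ∞
      (fun z => (starRingEnd ℂ)
        (trivializationAt ℂ L (b z₀) (TotalSpace.mk' ℂ (b z) (s z))).2) z₀ :=
    ContMDiffAt.comp z₀ (g := fun c : ℂ => (starRingEnd ℂ) c)
      (Complex.conjCLE.contDiff.contMDiff.contMDiffAt) hs.2
  refine (contMDiffAt_mul_complex (contMDiffAt_mul_complex hconj ht.2) hee).congr_of_eventuallyEq ?_
  filter_upwards [hs.1.continuousAt.eventually hev] with z hz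
  conv_lhs => rw [eq_smul_of_trivialization hz.1 hz.2 (s z),
    eq_smul_of_trivialization hz.1 hz.2 (t z),
    inner_smul_left, inner_smul_right, ← mul_assoc]

end Families

section Parameters

variable {k : ℕ}

/-- The sections `A_u` form a smooth family for `u` near `u₀`. -/
def SmoothNear (A : Eu k → ∀ x, L x) (u₀ : Eu k) : Prop :=
  ∀ᶠ u in 𝓝 u₀, ∀ x : M, ContMDiffAt (𝓘(ℝ, Eu k).prod (𝓡 (2 * n))) ((𝓡 (2 * n)).prod 𝓘(ℝ, ℂ)) ∞
    (fun z : Eu k × M => TotalSpace.mk' ℂ z.2 (A z.1 z.2)) (u, x)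

/-- The pointwise form does not require the members to be bundled as smooth sections, so it applies
directly to rescaled families and to parameter derivatives; `SmoothNear.mem` recovers membership. -/
lemma isSmoothFamily_iff {α : Eu k → SmoothSections n L} {u₀ : Eu k} :
    IsSmoothFamily α u₀ ↔ SmoothNear (n := n) (fun u => (α u).1) u₀ := by
  constructor
  · rintro ⟨W, hW, H⟩
    filter_upwards [eventually_mem_nhds_iff.2 hW] with u hu x
    exact H.contMDiffAt (prod_mem_nhds hu Filter.univ_mem)
  · intro h
    exact ⟨_, h, fun z hz => (hz.1 z.2).contMDiffWithinAt⟩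

lemma SmoothNear.eventually {A : Eu k → ∀ x, L x} {u₀ : Eu k} (h : SmoothNear (n := n) A u₀) :
    ∀ᶠ u in 𝓝 u₀, SmoothNear (n := n) A u :=
  eventually_eventually_nhds.2 h

lemma SmoothNear.mem {A : Eu k → ∀ x, L x} {u₀ : Eu k} (h : SmoothNear (n := n) A u₀) :
    A u₀ ∈ SmoothSections n L := fun x =>
  ContMDiffAt.comp x (g := fun z : Eu k × M => TotalSpace.mk' ℂ z.2 (A z.1 z.2))
    (f := fun x => (u₀, x)) (h.self_of_nhds x) (contMDiffAt_const.prodMk contMDiffAt_id)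

lemma SmoothNear.congr {A B : Eu k → ∀ x, L x} {u₀ : Eu k} (h : SmoothNear (n := n) A u₀)
    (hAB : A =ᶠ[𝓝 u₀] B) : SmoothNear (n := n) B u₀ := by
  filter_upwards [h, hAB.eventuallyEq_nhds] with u hu huv x
  refine (hu x).congr_of_eventuallyEq ?_
  filter_upwards [(continuous_fst (X := Eu k) (Y := M)).continuousAt.eventually huv] with z hz
  rw [← hz]

lemma SmoothNear.smul {A : Eu k → ∀ x, L x} {g : Eu k → ℂ} {u₀ : Eu k}
    (h : SmoothNear (n := n) A u₀) (hg : ∀ᶠ u in 𝓝 u₀, ContDiffAt ℝ ∞ g u) :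
    SmoothNear (n := n) (fun u => g u • A u) u₀ := by
  filter_upwards [h, hg] with u hu hgu x
  exact contMDiffAt_smul_along (hgu.contMDiffAt.comp (u, x) contMDiffAt_fst) (hu x)

lemma contMDiffAt_comp_fiber {A : Eu k → ∀ x, L x} {u : Eu k} {x : M}
    (h : ContMDiffAt (𝓘(ℝ, Eu k).prod (𝓡 (2 * n))) ((𝓡 (2 * n)).prod 𝓘(ℝ, ℂ)) ∞
      (fun z : Eu k × M => TotalSpace.mk' ℂ z.2 (A z.1 z.2)) (u, x)) :
    DifferentiableAt ℝ (fun y => A y x) u := by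
  rw [contMDiffAt_totalSpace] at h
  have hd := differentiableAt_of_contMDiffAt_prod
    (F := fun (y : Eu k) (x' : M) => (trivializationAt ℂ L x ⟨x', A y x'⟩).2) h.2
  set φ := (trivializationAt ℂ L x).continuousLinearEquivAt ℝ x
    (FiberBundle.mem_baseSet_trivializationAt' x)
  exact φ.comp_differentiableAt_iff.1 hd

lemma SmoothNear.differentiableAt {A : Eu k → ∀ x, L x} {u : Eu k} (h : SmoothNear (n := n) A u)
    (x : M) : DifferentiableAt ℝ (fun y => A y x) u :=
  contMDiffAt_comp_fiber (h.self_of_nhds x)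

/-- For fixed `x` the derivative is taken in the fixed vector space `L x`. A trivialization is
linear on fibres and so commutes with it: the coordinate of the derivative is the partial derivative
of the coordinate. -/
lemma SmoothNear.partial_fderiv {A : Eu k → ∀ x, L x} {u₀ : Eu k} (h : SmoothNear (n := n) A u₀)
    (v : Eu k) : SmoothNear (n := n) (fun u x => fderiv ℝ (fun y => A y x) u v) u₀ := by
  filter_upwards [h.eventually] with u hu x
  have h0 := contMDiffAt_totalSpace.1 (hu.self_of_nhds x)
  refine contMDiffAt_totalSpace.2 ⟨contMDiffAt_snd, ?_⟩
  have h1 := contMDiffAt_partial_fderiv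
    (F := fun (y : Eu k) (x' : M) => (trivializationAt ℂ L x ⟨x', A y x'⟩).2) h0.2
  have h2 : ContMDiffAt (𝓘(ℝ, Eu k).prod (𝓡 (2 * n))) 𝓘(ℝ, ℂ) ∞ (fun z : Eu k × M =>
      fderiv ℝ (fun y => (trivializationAt ℂ L x ⟨z.2, A y z.2⟩).2) z.1 v) (u, x) :=
    h1.clm_apply contMDiffAt_const
  refine h2.congr_of_eventuallyEq (f₁ := fun z : Eu k × M =>
    (trivializationAt ℂ L x ⟨z.2, fderiv ℝ (fun y => A y z.2) z.1 v⟩).2) ?_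
  filter_upwards [continuous_fst.continuousAt.eventually hu.eventually,
    eventually_mem_baseSet (L := L) (b := fun z : Eu k × M => z.2) (z₀ := (u, x))
      continuous_snd.continuousAt] with z hz hzx
  set φ := (trivializationAt ℂ L x).continuousLinearEquivAt ℝ z.2 hzx
  change φ (fderiv ℝ (fun y => A y z.2) z.1 v) = fderiv ℝ (fun y => φ (A y z.2)) z.1 v
  have := (φ.hasFDerivAt (x := A z.1 z.2)).comp z.1 (hz.differentiableAt z.2).hasFDerivAt
  exact (DFunLike.congr_fun this.fderiv v).symm

variable [T2Space M] (hL : IsSmoothHermitian n L)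

include hL

lemma SmoothNear.inner {A B : Eu k → ∀ x, L x} {u₀ : Eu k} (hA : SmoothNear (n := n) A u₀)
    (hB : SmoothNear (n := n) B u₀) :
    ∀ᶠ u in 𝓝 u₀, ∀ x : M, ContMDiffAt (𝓘(ℝ, Eu k).prod (𝓡 (2 * n))) 𝓘(ℝ, ℂ) ∞
      (fun z : Eu k × M => ⟪A z.1 z.2, B z.1 z.2⟫_ℂ) (u, x) := by
  filter_upwards [hA, hB] with u hAu hBu x
  exact contMDiffAt_inner_along hL (hAu x) (hBu x)

lemma continuous_inner_section {s t : ∀ x, L x} (hs : s ∈ SmoothSections n L)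
    (ht : t ∈ SmoothSections n L) : Continuous fun x => ⟪s x, t x⟫_ℂ := (hL s hs t ht).continuous

variable [CompactSpace M] [MeasurableSpace M] [BorelSpace M] {μ : Measure M} [IsFiniteMeasure μ]

lemma integrable_inner_section {s t : ∀ x, L x} (hs : s ∈ SmoothSections n L)
    (ht : t ∈ SmoothSections n L) : Integrable (fun x => ⟪s x, t x⟫_ℂ) μ :=
  (continuous_inner_section hL hs ht).integrable_of_hasCompactSupport (.of_compactSpace _)

lemma SmoothNear.contDiffAt_l2 {A B : Eu k → ∀ x, L x} {u₀ : Eu k} (hA : SmoothNear (n := n) A u₀)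
    (hB : SmoothNear (n := n) B u₀) : ContDiffAt ℝ ∞ (fun u => l2 μ (A u) (B u)) u₀ := by
  obtain ⟨W, hW, hWo, hu⟩ := eventually_nhds_iff.1 (hA.inner hL hB)
  exact (contDiffOn_integral_of_contMDiffAt μ (F := fun u x => ⟪A u x, B u x⟫_ℂ) hWo hW).contDiffAt
    (hWo.mem_nhds hu)

lemma SmoothNear.fderiv_l2 {A B : Eu k → ∀ x, L x} {u₀ : Eu k} (hA : SmoothNear (n := n) A u₀)
    (hB : SmoothNear (n := n) B u₀) (v : Eu k) :
    fderiv ℝ (fun u => l2 μ (A u) (B u)) u₀ v =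
      l2 μ (fun x => fderiv ℝ (fun y => A y x) u₀ v) (B u₀) +
        l2 μ (A u₀) (fun x => fderiv ℝ (fun y => B y x) u₀ v) := by
  obtain ⟨W, hW, hWo, hu⟩ := eventually_nhds_iff.1 (hA.inner hL hB)
  have h := hasFDerivAt_integral_of_contMDiffAt μ (F := fun u x => ⟪A u x, B u x⟫_ℂ) hWo hW hu
  have hD : ∀ x, fderiv ℝ (fun y => ⟪A y x, B y x⟫_ℂ) u₀ v =
      ⟪fderiv ℝ (fun y => A y x) u₀ v, B u₀ x⟫_ℂ + ⟪A u₀ x, fderiv ℝ (fun y => B y x) u₀ v⟫_ℂ := by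
    intro x
    rw [fderiv_inner_apply ℂ (hA.differentiableAt x) (hB.differentiableAt x), add_comm]
  -- Integrability of the operator-valued derivative is needed to move evaluation at `v` inside the
  -- integral.
  have hi : Integrable (fun x => fderiv ℝ (fun y => ⟪A y x, B y x⟫_ℂ) u₀) μ := by
    have : Continuous fun x => fderiv ℝ (fun y => ⟪A y x, B y x⟫_ℂ) u₀ :=
      continuous_iff_continuousAt.2 fun x => ContinuousAt.comp
        (g := fun z : Eu k × M => fderiv ℝ (fun y => ⟪A y z.2, B y z.2⟫_ℂ) z.1)
        (f := fun x => (u₀, x))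
        (contMDiffAt_partial_fderiv (F := fun u x => ⟪A u x, B u x⟫_ℂ) (hW u₀ hu x)).continuousAt
        (by fun_prop)
    exact this.integrable_of_hasCompactSupport (.of_compactSpace _)
  change fderiv ℝ (fun u => ∫ x, ⟪A u x, B u x⟫_ℂ ∂μ) u₀ v = _
  rw [h.fderiv, ContinuousLinearMap.integral_apply hi]
  simp_rw [hD]
  exact integral_add (integrable_inner_section hL (hA.partial_fderiv v).mem hB.mem)
    (integrable_inner_section hL hA.mem (hB.partial_fderiv v).mem)

end Parameters

end LineBundle

section LineBundle

variable {n : ℕ} {M : Type u} [TopologicalSpace M] [ChartedSpace (Eu (2 * n)) M]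
  {L : M → Type v} [TopologicalSpace (TotalSpace ℂ L)]
  [∀ x, NormedAddCommGroup (L x)] [∀ x, InnerProductSpace ℂ (L x)] [FiberBundle ℂ L]
  [VectorBundle ℂ ℂ L] [VectorBundle ℝ ℂ L]
  [IsManifold (𝓡 (2 * n)) ∞ M] [ContMDiffVectorBundle ∞ ℂ L (𝓡 (2 * n))]

/-! ### The `L²` product, lines of sections, and unit functionals. -/

section L2

variable [MeasurableSpace M] {μ : Measure M}

lemma l2_smul_right (s t : ∀ x, L x) (c : ℂ) : l2 μ s (c • t) = c * l2 μ s t := by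
  simp only [l2, Pi.smul_apply, inner_smul_right]
  exact integral_const_mul c _

lemma l2_conj_symm (s t : ∀ x, L x) : (starRingEnd ℂ) (l2 μ s t) = l2 μ t s := by
  simp only [l2, ← integral_conj, inner_conj_symm]

lemma l2_smul_left (s t : ∀ x, L x) (c : ℂ) :
    l2 μ (c • s) t = (starRingEnd ℂ) c * l2 μ s t := by
  rw [← l2_conj_symm, l2_smul_right, map_mul, l2_conj_symm]

variable [T2Space M] [CompactSpace M] [BorelSpace M] [IsFiniteMeasure μ]

lemma l2_add_right (hL : IsSmoothHermitian n L) {s t t' : ∀ x, L x} (hs : s ∈ SmoothSections n L)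
    (ht : t ∈ SmoothSections n L) (ht' : t' ∈ SmoothSections n L) :
    l2 μ s (t + t') = l2 μ s t + l2 μ s t' := by
  simp only [l2, Pi.add_apply, inner_add_right]
  exact integral_add (integrable_inner_section hL hs ht) (integrable_inner_section hL hs ht')

lemma l2_add_left (hL : IsSmoothHermitian n L) {s t t' : ∀ x, L x} (hs : s ∈ SmoothSections n L)
    (ht : t ∈ SmoothSections n L) (ht' : t' ∈ SmoothSections n L) :
    l2 μ (t + t') s = l2 μ t s + l2 μ t' s := by
  rw [← l2_conj_symm, l2_add_right hL hs ht ht', map_add, l2_conj_symm, l2_conj_symm]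

lemma l2_self (s : ∀ x, L x) : l2 μ s s = ((∫ x, ‖s x‖ ^ 2 ∂μ : ℝ) : ℂ) := by
  simp only [l2, inner_self_eq_norm_sq_to_K]
  rw [← integral_complex_ofReal]
  simp

/-- The integrand is continuous, nonnegative and nonzero somewhere, and open sets have positive
measure. This makes the `L²` product definite. -/
lemma integral_norm_sq_pos [μ.IsOpenPosMeasure] (hL : IsSmoothHermitian n L) {s : ∀ x, L x}
    (hs : s ∈ SmoothSections n L) (h0 : s ≠ 0) : 0 < ∫ x, ‖s x‖ ^ 2 ∂μ := by
  have hc : Continuous fun x => ‖s x‖ ^ 2 := by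
    refine (Complex.continuous_re.comp (continuous_inner_section hL hs hs)).congr fun x => ?_
    simp [inner_self_eq_norm_sq_to_K, ← Complex.ofReal_pow]
  obtain ⟨x, hx⟩ := Function.ne_iff.1 h0
  exact Continuous.integral_pos_of_hasCompactSupport_nonneg_nonzero hc (.of_compactSpace _)
    (fun x => by positivity) (x := x) (by simpa using hx)

lemma l2_self_ne_zero [μ.IsOpenPosMeasure] (hL : IsSmoothHermitian n L) {s : ∀ x, L x}
    (hs : s ∈ SmoothSections n L) (h0 : s ≠ 0) : l2 μ s s ≠ 0 := by
  rw [l2_self]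
  exact_mod_cast (integral_norm_sq_pos hL hs h0).ne'

end L2

section Lines

lemma mem_submodule_of_eq_mk {p : ProjSections n L} {α : SmoothSections n L} {h : α ≠ 0}
    (hp : p = Projectivization.mk ℂ α h) : α ∈ p.submodule := by
  rw [hp, Projectivization.submodule_mk]
  exact Submodule.mem_span_singleton_self α

lemma eq_mk_of_mem_submodule {p : ProjSections n L} {α : SmoothSections n L} (h : α ≠ 0)
    (hα : α ∈ p.submodule) : p = Projectivization.mk ℂ α h := by
  rw [Projectivization.submodule_eq, Submodule.mem_span_singleton] at hα
  obtain ⟨c, hc⟩ := hα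
  have hc0 : c ≠ 0 := by
    rintro rfl
    exact h (by rw [← hc, zero_smul])
  rw [← p.mk_rep, Projectivization.mk_eq_mk_iff']
  exact ⟨c⁻¹, by rw [← hc, inv_smul_smul₀ hc0]⟩

lemma exists_smul_eq_of_mem_submodule {p : ProjSections n L} {α β : SmoothSections n L} (h : α ≠ 0)
    (hα : α ∈ p.submodule) (hβ : β ∈ p.submodule) : ∃ c : ℂ, β = c • α := by
  rw [eq_mk_of_mem_submodule h hα, Projectivization.submodule_mk,
    Submodule.mem_span_singleton] at hβ
  obtain ⟨c, hc⟩ := hβ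
  exact ⟨c, hc.symm⟩

end Lines

namespace O1

variable [MeasurableSpace M] {μ : Measure M}

lemma l2_dualVec (ξ : O1 n L μ) : l2 μ ξ.dualVec.1 ξ.dualVec.1 = 1 := ξ.2.2.choose_spec.2

lemma dualVec_ne_zero (ξ : O1 n L μ) : ξ.dualVec ≠ 0 := by
  intro h
  have := ξ.apply_dualVec
  simp only [h] at this
  exact zero_ne_one ((map_zero ξ.2.1).symm.trans this)

lemma proj_eq_mk (ξ : O1 n L μ) : ξ.proj = Projectivization.mk ℂ ξ.dualVec ξ.dualVec_ne_zero :=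
  eq_mk_of_mem_submodule _ ξ.dualVec_mem

/-- The line is one-dimensional, so the condition `ξ s = 1` already determines `s`. The choice made
in `dualVec` is therefore harmless, and any representative can be compared with it. -/
lemma dualVec_eq {ξ : O1 n L μ} {α : SmoothSections n L} (h : α ∈ ξ.1.submodule)
    (h1 : ξ.2.1 ⟨α, h⟩ = 1) : ξ.dualVec = α := by
  obtain ⟨c, rfl⟩ := exists_smul_eq_of_mem_submodule ξ.dualVec_ne_zero ξ.dualVec_mem h
  have : ξ.2.1 (c • ⟨ξ.dualVec, ξ.dualVec_mem⟩) = 1 := h1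
  rw [map_smul, ξ.apply_dualVec, smul_eq_mul, mul_one] at this
  rw [this, one_smul]

lemma ext_of_dualVec {ξ η : O1 n L μ} (h : ξ.dualVec = η.dualVec) : ξ = η := by
  have hp : ξ.1 = η.1 := by
    change ξ.proj = η.proj
    rw [proj_eq_mk, proj_eq_mk]
    simp only [h]
  obtain ⟨p, ξ, hξ⟩ := ξ
  obtain ⟨q, η, hη⟩ := η
  obtain rfl : p = q := hp
  congr 2
  ext ⟨t, ht⟩
  set X : O1 n L μ := ⟨p, ξ, hξ⟩
  set Y : O1 n L μ := ⟨p, η, hη⟩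
  obtain ⟨c, rfl⟩ := exists_smul_eq_of_mem_submodule X.dualVec_ne_zero X.dualVec_mem ht
  have h1 : X.2.1 (c • ⟨X.dualVec, X.dualVec_mem⟩) = c := by rw [map_smul, X.apply_dualVec]; simp
  have h2 : Y.2.1 (c • ⟨Y.dualVec, Y.dualVec_mem⟩) = c := by rw [map_smul, Y.apply_dualVec]; simp
  refine h1.trans (h2.symm.trans (congrArg Y.2.1 (Subtype.ext ?_)))
  exact congrArg (c • ·) h.symm

lemma dualVec_smul (g : Circle) (ξ : O1 n L μ) : (g • ξ).dualVec = (g : ℂ) • ξ.dualVec := by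
  refine dualVec_eq (ξ.1.submodule.smul_mem _ ξ.dualVec_mem) ?_
  have : (g • ξ).2.1 ((g : ℂ) • ⟨ξ.dualVec, ξ.dualVec_mem⟩) =
    ((g⁻¹ : Circle) : ℂ) • ξ.2.1 ((g : ℂ) • ⟨ξ.dualVec, ξ.dualVec_mem⟩) := rfl
  refine this.trans ?_
  rw [map_smul, ξ.apply_dualVec]
  simp

/-- The existential over local representatives disappears, since a representative can only be the
family of unit sections itself. -/
lemma isPlot_iff {k : ℕ} {ξ : Eu k → O1 n L μ} :
    IsPlot ξ ↔ ∀ u, SmoothNear (n := n) (fun y => (ξ y).dualVec.1) u := by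
  refine forall_congr' fun u => ?_
  constructor
  · rintro ⟨α, hα, h⟩
    refine (isSmoothFamily_iff.1 hα).congr ?_
    filter_upwards [h] with y ⟨h1, h2⟩
    rw [dualVec_eq h1 h2]
  · intro h
    exact ⟨_, isSmoothFamily_iff.2 h, .of_forall fun y => ⟨(ξ y).dualVec_mem, (ξ y).apply_dualVec⟩⟩

lemma smooth_smul : DSmooth fun a : Circle × O1 n L μ => a.1 • a.2 := by
  intro k p hp
  obtain ⟨h1, h2⟩ := isPlot_prod_iff.1 hp
  rw [isPlot_circle_iff] at h1
  rw [isPlot_iff] at h2 ⊢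
  intro u
  refine ((h2 u).smul (.of_forall fun y => h1.contDiffAt)).congr (.of_forall fun y => ?_)
  exact (congrArg Subtype.val (dualVec_smul (p y).1 (p y).2)).symm

lemma smooth_proj : DSmooth (proj : O1 n L μ → ProjSections n L) := by
  intro k ξ hξ u
  exact ⟨_, isSmoothFamily_iff.2 (isPlot_iff.1 hξ u),
    .of_forall fun y => ⟨(ξ y).dualVec_ne_zero, (ξ y).proj_eq_mk⟩⟩

variable [T2Space M] [CompactSpace M] [BorelSpace M] [IsFiniteMeasure μ]

/-- The unit functional `⟪s, ·⟫` on the line `p` spanned by the unit section `s`. -/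
noncomputable def ofUnit (hL : IsSmoothHermitian n L) (p : ProjSections n L)
    (s : SmoothSections n L) (hs : s ∈ p.submodule) (h1 : l2 μ s.1 s.1 = 1) : O1 n L μ :=
  ⟨p, { toFun := fun t => l2 μ s.1 t.1.1
        map_add' := fun _ _ => l2_add_right hL s.2 (Subtype.prop _) (Subtype.prop _)
        map_smul' := fun c _ => l2_smul_right _ _ c }, ⟨s, hs⟩, h1, h1⟩

lemma dualVec_ofUnit (hL : IsSmoothHermitian n L) (p : ProjSections n L)
    (s : SmoothSections n L) (hs : s ∈ p.submodule) (h1 : l2 μ s.1 s.1 = 1) :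
    (ofUnit hL p s hs h1).dualVec = s :=
  dualVec_eq hs h1

section Connection

variable {k : ℕ} {ξ : Eu k → O1 n L μ}

lemma isOneForm_chernForm (hL : IsSmoothHermitian n L) : IsOneForm (chernForm n L μ) where
  linear k ξ hξ u := by
    have h := isPlot_iff.1 hξ u
    constructor
    · intro v w
      simp only [chernForm, map_add]
      rw [← Complex.add_im, ← l2_add_right hL (ξ u).dualVec.2 (h.partial_fderiv v).mem
        (h.partial_fderiv w).mem]
      rfl
    · intro c v
      simp only [chernForm, map_smul]
      have : (fun x => c • fderiv ℝ (fun y => (ξ y).dualVec.1 x) u v) =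
          ((c : ℂ) • fun x => fderiv ℝ (fun y => (ξ y).dualVec.1 x) u v) := by
        ext x
        simp
      rw [this, l2_smul_right, Complex.im_ofReal_mul, smul_eq_mul]
  smooth k ξ hξ v := by
    rw [contDiff_iff_contDiffAt]
    intro u
    have h := isPlot_iff.1 hξ u
    exact Complex.imCLM.contDiff.contDiffAt.comp u (h.contDiffAt_l2 hL (h.partial_fderiv v))
  natural k m ξ f hξ hf u v := by
    have h := isPlot_iff.1 hξ (f u)
    simp only [chernForm]
    congr 2
    ext x
    have h1 := (h.differentiableAt x).hasFDerivAt.comp u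
      (hf.differentiable (by simp) u).hasFDerivAt
    exact DFunLike.congr_fun h1.fderiv v

lemma isCircleConnection_chernForm (hL : IsSmoothHermitian n L) :
    IsCircleConnection (chernForm n L μ) where
  toIsOneForm := isOneForm_chernForm hL
  gauge k ξ γ hξ hγ u v := by
    have h := isPlot_iff.1 hξ u
    rw [isPlot_circle_iff] at hγ
    -- Leibniz rule `d(γ s) = γ ds + dγ s`. Pairing with `γ s` gives `⟪s, ds⟫ + conj(γ) dγ`, because
    -- `|γ| = 1` and `⟪s, s⟫ = 1`.
    have hd : (fun x => fderiv ℝ (fun y => (γ y • ξ y).dualVec.1 x) u v) =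
        (γ u : ℂ) • (fun x => fderiv ℝ (fun y => (ξ y).dualVec.1 x) u v) +
          fderiv ℝ (fun y => (γ y : ℂ)) u v • (ξ u).dualVec.1 := by
      ext x
      have h1 : (fun y => (γ y • ξ y).dualVec.1 x) = fun y => (γ y : ℂ) • (ξ y).dualVec.1 x := by
        ext y
        rw [dualVec_smul]
        rfl
      rw [h1, fderiv_fun_smul (hγ.differentiable (by simp) u) (h.differentiableAt x)]
      rfl
    simp only [chernForm]
    rw [hd, dualVec_smul]
    change (l2 μ ((γ u : ℂ) • (ξ u).dualVec.1) _).im = _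
    have hγ1 : (starRingEnd ℂ) (γ u : ℂ) * (γ u : ℂ) = 1 := by
      rw [← Complex.normSq_eq_conj_mul_self]; simp
    rw [l2_smul_left, l2_add_right hL (ξ u).dualVec.2
        ((SmoothSections n L).smul_mem _ (h.partial_fderiv v).mem)
        ((SmoothSections n L).smul_mem _ (ξ u).dualVec.2), l2_smul_right, l2_smul_right,
      l2_dualVec, mul_one, mul_add, ← mul_assoc, hγ1, one_mul, Complex.add_im]
    rfl

end Connection

end O1

end LineBundle

/-- The Hermitian form evaluated on the derivatives of a unit section `l α`, expressed through
the derivatives of `α`; here `a = ⟪α, α⟫` and `mv, mw` are the derivatives of `l`. -/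
lemma im_unit_hermitian_eq {a l mv mw Va aV Wa aW VW : ℂ} (ha : (starRingEnd ℂ) a = a)
    (hl : (starRingEnd ℂ) l * l * a = 1) (hV : (starRingEnd ℂ) aV = Va)
    (hW : (starRingEnd ℂ) aW = Wa)
    (hv : (starRingEnd ℂ) mv * l * a + (starRingEnd ℂ) l * l * Va +
      ((starRingEnd ℂ) l * mv * a + (starRingEnd ℂ) l * l * aV) = 0)
    (hw : (starRingEnd ℂ) mw * l * a + (starRingEnd ℂ) l * l * Wa +
      ((starRingEnd ℂ) l * mw * a + (starRingEnd ℂ) l * l * aW) = 0) :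
    ((starRingEnd ℂ) mv * mw * a + (starRingEnd ℂ) mv * l * aW + (starRingEnd ℂ) l * mw * Va +
      (starRingEnd ℂ) l * l * VW).im = (VW / a - Va * aW / a ^ 2).im := by
  have ha0 : a ≠ 0 := by
    rintro rfl
    simp at hl
  -- With `s = l α`, `P` and `Q` are `⟪s, ds(v)⟫` and `⟪s, ds(w)⟫`. The hypotheses `hv`, `hw` are
  -- the derivatives of `⟪s, s⟫ = 1`, so both are purely imaginary.
  set P := (starRingEnd ℂ) l * mv * a + (starRingEnd ℂ) l * l * aV with hP
  set Q := (starRingEnd ℂ) l * mw * a + (starRingEnd ℂ) l * l * aW with hQ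
  have hPc : (starRingEnd ℂ) P = -P := by
    rw [eq_neg_iff_add_eq_zero, ← hv, hP]
    simp only [map_add, map_mul, Complex.conj_conj, ha, hV]
    ring
  have hQc : (starRingEnd ℂ) Q = -Q := by
    rw [eq_neg_iff_add_eq_zero, ← hw, hQ]
    simp only [map_add, map_mul, Complex.conj_conj, ha, hW]
    ring
  have hl' : (starRingEnd ℂ) l * l = 1 / a := by rw [eq_div_iff ha0, hl]
  -- Orthogonal splitting of `ds` along `s`: the part of `⟪ds(v), ds(w)⟫` along `s` is `conj(P) Q`,
  -- a real number, and the rest is the Fubini-Study expression.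
  have key : (starRingEnd ℂ) mv * mw * a + (starRingEnd ℂ) mv * l * aW +
      (starRingEnd ℂ) l * mw * Va + (starRingEnd ℂ) l * l * VW =
      (VW / a - Va * aW / a ^ 2) + (starRingEnd ℂ) P * Q := by
    have e : (starRingEnd ℂ) P * Q = ((starRingEnd ℂ) l * l * a) * ((starRingEnd ℂ) mv * mw * a)
        + ((starRingEnd ℂ) l * l) * a * ((starRingEnd ℂ) mv * l * aW) +
        ((starRingEnd ℂ) l * l) * a * ((starRingEnd ℂ) l * mw * Va) +
        ((starRingEnd ℂ) l * l) * ((starRingEnd ℂ) l * l) * (Va * aW) := by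
      simp only [hP, hQ, map_add, map_mul, Complex.conj_conj, ha, hV]
      ring
    rw [e, hl, hl']
    field_simp
    ring
  have him : ((starRingEnd ℂ) P * Q).im = 0 := by
    rw [← Complex.conj_eq_iff_im, map_mul, Complex.conj_conj, hPc, hQc]
    ring
  rw [key, Complex.add_im, him, add_zero]

/-! ### The curvature of `𝒪(1)`. -/

section LineBundle

variable {n : ℕ} {M : Type u} [TopologicalSpace M] [ChartedSpace (Eu (2 * n)) M]
  {L : M → Type v} [TopologicalSpace (TotalSpace ℂ L)]
  [∀ x, NormedAddCommGroup (L x)] [∀ x, InnerProductSpace ℂ (L x)] [FiberBundle ℂ L]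
  [VectorBundle ℂ ℂ L] [VectorBundle ℝ ℂ L]
  [IsManifold (𝓡 (2 * n)) ∞ M] [ContMDiffVectorBundle ∞ ℂ L (𝓡 (2 * n))]
  {k : ℕ}

lemma SmoothNear.contDiffAt_fiber {A : Eu k → ∀ x, L x} {u : Eu k} (h : SmoothNear (n := n) A u)
    (x : M) : ContDiffAt ℝ ∞ (fun y => A y x) u := by
  have h := contMDiffAt_totalSpace.1 (h.self_of_nhds x)
  have h1 : ContMDiffAt 𝓘(ℝ, Eu k) 𝓘(ℝ, ℂ) ∞
      (fun y => (trivializationAt ℂ L x ⟨x, A y x⟩).2) u :=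
    ContMDiffAt.comp u (g := fun z : Eu k × M => (trivializationAt ℂ L x ⟨z.2, A z.1 z.2⟩).2) h.2
      (contMDiffAt_id.prodMk contMDiffAt_const)
  set φ := (trivializationAt ℂ L x).continuousLinearEquivAt ℝ x
    (FiberBundle.mem_baseSet_trivializationAt' x)
  exact φ.comp_contDiffAt_iff.1 h1.contDiffAt

lemma SmoothNear.fderiv_fderiv_comm {A : Eu k → ∀ x, L x} {u : Eu k}
    (h : SmoothNear (n := n) A u) (v w : Eu k) :
    (fun x => fderiv ℝ (fun y => fderiv ℝ (fun y => A y x) y w) u v) =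
      fun x => fderiv ℝ (fun y => fderiv ℝ (fun y => A y x) y v) u w := by
  ext x
  have hc := h.contDiffAt_fiber x
  have hs := hc.isSymmSndFDerivAt
    (by rw [minSmoothness_of_isRCLikeNormedField]; exact ENat.LEInfty.out)
  have hd : DifferentiableAt ℝ (fderiv ℝ (fun y => A y x)) u :=
    (hc.fderiv_right (m := ∞) (by simp)).differentiableAt (by simp)
  rw [fderiv_clm_apply hd (differentiableAt_const _),
    fderiv_clm_apply hd (differentiableAt_const _)]
  simpa using hs v w

variable [T2Space M] [CompactSpace M] [MeasurableSpace M] [BorelSpace M] {μ : Measure M}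
  [IsFiniteMeasure μ]

/-- The terms `⟪s, ∂ᵥ∂_w s⟫` cancel by symmetry of second derivatives. The two remaining products
are complex conjugates, whence the factor `2`. -/
lemma O1.d_chernForm (hL : IsSmoothHermitian n L) {ξ : Eu k → O1 n L μ} (hξ : IsPlot ξ)
    (u v w : Eu k) : (chernForm n L μ).d ξ u v w =
      2 * (l2 μ (fun x => fderiv ℝ (fun y => (ξ y).dualVec.1 x) u v)
        (fun x => fderiv ℝ (fun y => (ξ y).dualVec.1 x) u w)).im := by
  have h := O1.isPlot_iff.1 hξ u
  have hd : ∀ v w : Eu k, fderiv ℝ (fun y => chernForm n L μ ξ y w) u v =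
      (l2 μ (fun x => fderiv ℝ (fun y => (ξ y).dualVec.1 x) u v)
        (fun x => fderiv ℝ (fun y => (ξ y).dualVec.1 x) u w)).im +
      (l2 μ (ξ u).dualVec.1 (fun x =>
        fderiv ℝ (fun y => fderiv ℝ (fun y => (ξ y).dualVec.1 x) y w) u v)).im := by
    intro v w
    have h1 := (h.contDiffAt_l2 (μ := μ) hL (h.partial_fderiv w)).differentiableAt (by simp)
    have h2 := (Complex.imCLM.hasFDerivAt.comp u h1.hasFDerivAt).fderiv
    have h3 := DFunLike.congr_fun h2 v
    rw [ContinuousLinearMap.comp_apply, h.fderiv_l2 hL (h.partial_fderiv w)] at h3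
    exact h3
  rw [PreForm.d, hd, hd, h.fderiv_fderiv_comm v w, ← l2_conj_symm
    (fun x => fderiv ℝ (fun y => (ξ y).dualVec.1 x) u v), Complex.conj_im]
  ring

lemma O1.d_chernForm_eq_fubiniStudy [μ.IsOpenPosMeasure] (hL : IsSmoothHermitian n L)
    {ξ : Eu k → O1 n L μ} (hξ : IsPlot ξ) {α : Eu k → SmoothSections n L} {u : Eu k}
    (hα : IsLift (fun z => (ξ z).proj) α u) (v w : Eu k) :
    (chernForm n L μ).d ξ u v w = 2 * Real.pi * fubiniStudy μ (α u).1
      (fun x => fderiv ℝ (fun z => (α z).1 x) u v)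
      (fun x => fderiv ℝ (fun z => (α z).1 x) u w) := by
  have hS := O1.isPlot_iff.1 hξ u
  have hA := isSmoothFamily_iff.1 hα.1
  obtain ⟨hα0, hp⟩ := hα.2.self_of_nhds
  -- Pairing `s = l α` with `α` gives this formula for the coefficient, which shows that it depends
  -- smoothly on the parameter.
  set l : Eu k → ℂ := fun z => l2 μ (α z).1 (ξ z).dualVec.1 / l2 μ (α z).1 (α z).1 with hl
  have hlc : ContDiffAt ℝ ∞ l u := by
    have h1 := hA.contDiffAt_l2 (μ := μ) hL hS
    have h2 := hA.contDiffAt_l2 (μ := μ) hL hA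
    exact (h1.mul (h2.inv (l2_self_ne_zero hL (α u).2
      fun h => hα0 (Subtype.ext h)))).congr_of_eventuallyEq
      (.of_forall fun y => div_eq_mul_inv _ _)
  have hSl : (fun z => (ξ z).dualVec.1) =ᶠ[𝓝 u] fun z => l z • (α z).1 := by
    filter_upwards [hα.2] with z ⟨hz0, hz⟩
    obtain ⟨c, hc⟩ := exists_smul_eq_of_mem_submodule hz0 (mem_submodule_of_eq_mk hz)
      (ξ z).dualVec_mem
    have hc' : (ξ z).dualVec.1 = c • (α z).1 := congrArg Subtype.val hc
    have : l z = c := by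
      simp only [hl]
      rw [hc', l2_smul_right, mul_div_cancel_right₀ _
        (l2_self_ne_zero hL (α z).2 fun h => hz0 (Subtype.ext h))]
    rw [this, hc']
  have hSu : (ξ u).dualVec.1 = l u • (α u).1 := hSl.self_of_nhds
  set V : Eu k → ∀ x, L x := fun v x => fderiv ℝ (fun z => (α z).1 x) u v with hV
  have hVm : ∀ v, V v ∈ SmoothSections n L := fun v => (hA.partial_fderiv v).mem
  have hαm := (α u).2
  set m : Eu k → ℂ := fun v => fderiv ℝ l u v with hm
  have hD : ∀ v, (fun x => fderiv ℝ (fun y => (ξ y).dualVec.1 x) u v) =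
      m v • (α u).1 + l u • V v := by
    intro v
    ext x
    have h1 : (fun y => (ξ y).dualVec.1 x) =ᶠ[𝓝 u] fun y => l y • (α y).1 x :=
      hSl.mono fun y hy => congrFun hy x
    rw [h1.fderiv_eq, fderiv_fun_smul (hlc.differentiableAt (by simp)) (hA.differentiableAt x),
      add_comm]
    rfl
  have hsm : ∀ (c : ℂ) {s : ∀ x, L x}, s ∈ SmoothSections n L → c • s ∈ SmoothSections n L :=
    fun c s hs => (SmoothSections n L).smul_mem c hs
  have hunit : l2 μ (l u • (α u).1) (l u • (α u).1) = 1 := by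
    rw [← hSu, (ξ u).l2_dualVec]
  -- The derivative of the constant function `⟪s, s⟫ = 1`, expanded through `ds = dl α + l dα`.
  have hconst : ∀ v, (starRingEnd ℂ) (m v) * l u * l2 μ (α u).1 (α u).1 +
      (starRingEnd ℂ) (l u) * l u * l2 μ (V v) (α u).1 +
      ((starRingEnd ℂ) (l u) * m v * l2 μ (α u).1 (α u).1 +
        (starRingEnd ℂ) (l u) * l u * l2 μ (α u).1 (V v)) = 0 := by
    intro v
    have h1 := hS.fderiv_l2 (μ := μ) hL hS v
    have h2 : (fun y => l2 μ (ξ y).dualVec.1 (ξ y).dualVec.1) = fun _ => 1 := by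
      ext y
      rw [(ξ y).l2_dualVec]
    rw [h2, fderiv_fun_const, hD v, hSu, l2_add_left hL (hsm _ hαm) (hsm _ hαm) (hsm _ (hVm v)),
      l2_add_right hL (hsm _ hαm) (hsm _ hαm) (hsm _ (hVm v))] at h1
    simp only [l2_smul_left, l2_smul_right] at h1
    refine Eq.trans ?_ h1.symm
    ring
  rw [O1.d_chernForm hL hξ, hD v, hD w,
    l2_add_left hL ((SmoothSections n L).add_mem (hsm _ hαm) (hsm _ (hVm w)))
      (hsm _ hαm) (hsm _ (hVm v)),
    l2_add_right hL (hsm _ hαm) (hsm _ hαm) (hsm _ (hVm w)),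
    l2_add_right hL (hsm _ (hVm v)) (hsm _ hαm) (hsm _ (hVm w))]
  simp only [l2_smul_left, l2_smul_right] at hunit ⊢
  have := im_unit_hermitian_eq (VW := l2 μ (V v) (V w)) (l2_conj_symm (α u).1 (α u).1)
    (Eq.trans (by ring) hunit) (l2_conj_symm (α u).1 (V v)) (l2_conj_symm (α u).1 (V w))
    (hconst v) (hconst w)
  rw [fubiniStudy, ← this]
  have hpi := Real.pi_ne_zero
  field_simp
  congr 1
  ring

end LineBundle

/-- A differentiable function with vanishing derivative on a connected manifold is constant. -/
lemma eq_of_mfderiv_eq_zero {E : Type*} [NormedAddCommGroup E] [NormedSpace ℝ E]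
    {X : Type*} [TopologicalSpace X] [ChartedSpace E X] [IsManifold 𝓘(ℝ, E) ∞ X]
    [PreconnectedSpace X] {F : Type*} [NormedAddCommGroup F] [NormedSpace ℝ F] {g : X → F}
    (hg : MDifferentiable 𝓘(ℝ, E) 𝓘(ℝ, F) g) (h0 : ∀ x, mfderiv 𝓘(ℝ, E) 𝓘(ℝ, F) g x = 0) (x y : X) :
    g x = g y := by
  have : IsManifold 𝓘(ℝ, E) 1 X := .of_le (n := ∞) ENat.LEInfty.out
  refine IsLocallyConstant.apply_eq_of_preconnectedSpace ?_ x y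
  rw [IsLocallyConstant.iff_eventually_eq]
  intro x
  set φ := extChartAt 𝓘(ℝ, E) x
  obtain ⟨r, hr, hball⟩ := Metric.isOpen_iff.1 (isOpen_extChartAt_target (I := 𝓘(ℝ, E)) x) (φ x)
    (mem_extChartAt_target x)
  have hd : ∀ y ∈ φ.target, HasFDerivAt (g ∘ φ.symm) (0 : E →L[ℝ] F) y := by
    intro y hy
    have h1 : MDifferentiableAt 𝓘(ℝ, E) 𝓘(ℝ, E) φ.symm y := by
      have := mdifferentiableWithinAt_extChartAt_symm (I := 𝓘(ℝ, E)) hy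
      rwa [ModelWithCorners.range_eq_univ, mdifferentiableWithinAt_univ] at this
    have h2 := (hg (φ.symm y)).hasMFDerivAt.comp y h1.hasMFDerivAt
    rw [h0] at h2
    exact h2.hasFDerivAt.congr_fderiv (by ext v; rfl)
  filter_upwards [extChartAt_source_mem_nhds (I := 𝓘(ℝ, E)) x,
    (continuousAt_extChartAt (I := 𝓘(ℝ, E)) x) (Metric.ball_mem_nhds _ hr)] with y hys hy
  have hc := (convex_ball (φ x) r).is_const_of_fderivWithin_eq_zero (𝕜 := ℝ) (f := g ∘ φ.symm)
    (fun z hz => (hd z (hball hz)).differentiableAt.differentiableWithinAt)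
    (fun z hz => by
      rw [fderivWithin_of_isOpen Metric.isOpen_ball hz, (hd z (hball hz)).fderiv])
    hy (Metric.mem_ball_self hr)
  have e1 : φ.symm (φ y) = y := φ.left_inv hys
  have e2 : φ.symm (φ x) = x := extChartAt_to_inv x
  exact (congrArg g e1).symm.trans (hc.trans (congrArg g e2))

/-- A unit vector having positive inner product with a vector of a line is its normalization. -/
lemma eq_normalize_of_inner_pos {E : Type*} [NormedAddCommGroup E] [InnerProductSpace ℂ E]
    {v w : E} {c : ℂ} (hc : w = c • v) (hw : ‖w‖ = 1) (hre : 0 < (⟪v, w⟫_ℂ).re)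
    (him : (⟪v, w⟫_ℂ).im = 0) : w = ((‖v‖⁻¹ : ℝ) : ℂ) • v := by
  subst hc
  have hv : v ≠ 0 := by rintro rfl; simp at hre
  have hv' : 0 < ‖v‖ := norm_pos_iff.2 hv
  rw [inner_smul_right, inner_self_eq_norm_sq_to_K] at hre him
  have e : (c * ((‖v‖ : ℝ) : ℂ) ^ 2) = c * ((‖v‖ ^ 2 : ℝ) : ℂ) := by push_cast; ring
  change 0 < (c * ((‖v‖ : ℝ) : ℂ) ^ 2).re at hre
  change (c * ((‖v‖ : ℝ) : ℂ) ^ 2).im = 0 at him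
  rw [e, Complex.re_mul_ofReal] at hre
  rw [e, Complex.im_mul_ofReal] at him
  have hci : c.im = 0 := by
    rcases mul_eq_zero.1 him with h | h
    · exact h
    · exact absurd h (by positivity)
  have hcr : 0 < c.re := pos_of_mul_pos_left hre (by positivity)
  have hcc : c = (c.re : ℂ) := Complex.ext rfl (by simpa using hci)
  congr 1
  rw [hcc, norm_smul, Complex.norm_real, Real.norm_of_nonneg hcr.le] at hw
  rw [hcc, eq_inv_of_mul_eq_one_left hw]

/-! ### Planckian cycles and uniqueness of positive partners. -/

section BohrSommerfeld

variable {n : ℕ} {M : Type u} [TopologicalSpace M] [ChartedSpace (Eu (2 * n)) M]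
  {L : M → Type v} [TopologicalSpace (TotalSpace ℂ L)]
  [∀ x, NormedAddCommGroup (L x)] [∀ x, InnerProductSpace ℂ (L x)] [FiberBundle ℂ L]
  [VectorBundle ℂ ℂ L] [VectorBundle ℝ ℂ L]
  [IsManifold (𝓡 (2 * n)) ∞ M] [ContMDiffVectorBundle ∞ ℂ L (𝓡 (2 * n))]
  {S₀ : Type u} [TopologicalSpace S₀] [ChartedSpace (Eu n) S₀] [IsManifold (𝓡 n) ∞ S₀]
  [ConnectedSpace S₀]
  {Ω : TwoForm n M} {a : HermitianConnection n L} {o : Homology n S₀} {c : Homology n M}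

lemma BS.nonempty (S : BS Ω a o c) : S.1.Nonempty := by
  obtain ⟨f, -, hr, -⟩ := S.2.exists_param
  rw [← hr]
  exact Set.range_nonempty f

/-- The Hermitian product of covariantly constant sections is constant. -/
lemma IsCovConst.inner_eq (hL : IsSmoothHermitian n L) {S : BS Ω a o c} {σ τ : (x : S.1) → L x}
    (hσ : IsCovConst S₀ a S.1 σ) (hτ : IsCovConst S₀ a S.1 τ) (x y : S.1) :
    ⟪σ x, τ x⟫_ℂ = ⟪σ y, τ y⟫_ℂ := by
  obtain ⟨f, hf, hr, -⟩ := S.2.exists_param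
  obtain ⟨s, hs, hsσ, hs0⟩ := hσ
  obtain ⟨t, ht, htτ, ht0⟩ := hτ
  obtain ⟨p, hp⟩ : x.1 ∈ Set.range f := by rw [hr]; exact x.2
  obtain ⟨q, hq⟩ : y.1 ∈ Set.range f := by rw [hr]; exact y.2
  set g : M → ℂ := fun x => ⟪s x, t x⟫_ℂ with hg
  have hgd : MDifferentiable (𝓡 (2 * n)) 𝓘(ℝ, ℂ) g := (hL s hs t ht).mdifferentiable (by simp)
  have hfd : MDifferentiable (𝓡 n) (𝓡 (2 * n)) f := hf.contMDiff.mdifferentiable (by simp)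
  -- The connection is metric and the extensions `s`, `t` have vanishing covariant derivative along
  -- `S`, so both terms of the derivative of `⟪s, t⟫` along `S` are zero. Connectedness of `S₀` then
  -- gives constancy.
  have h0 : ∀ q, mfderiv (𝓡 n) 𝓘(ℝ, ℂ) (g ∘ f) q = 0 := by
    intro q
    rw [mfderiv_comp q (hgd _) (hfd q)]
    ext v
    have h1 := a.metric s hs t ht (f q) (mfderiv (𝓡 n) (𝓡 (2 * n)) f q v)
    rw [hs0 f hf hr, ht0 f hf hr, inner_zero_left, inner_zero_right, add_zero] at h1
    exact h1
  have h1 := eq_of_mfderiv_eq_zero (hgd.comp hfd) h0 p q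
  rw [← hsσ, ← hsσ, ← htτ, ← htτ]
  simpa only [Function.comp, hp, hq] using h1

namespace Planck

lemma ext_of_apply {σ τ : Planck Ω a o c} (h : σ.proj = τ.proj)
    (h1 : ∀ x (hx : x ∈ σ.1.1) (hx' : x ∈ τ.1.1), σ.2.1 ⟨x, hx⟩ = τ.2.1 ⟨x, hx'⟩) : σ = τ := by
  obtain ⟨S, σ, hσ⟩ := σ
  obtain ⟨T, τ, hτ⟩ := τ
  obtain rfl : S = T := h
  congr 2
  ext x
  exact h1 x.1 x.2 x.2

/-- Planckian cycles over the same submanifold differ by a constant phase. -/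
lemma exists_smul_eq (hL : IsSmoothHermitian n L) {σ τ : Planck Ω a o c} (h : σ.proj = τ.proj) :
    ∃ g : Circle, τ = g • σ := by
  obtain ⟨S, σ, hσ⟩ := σ
  obtain ⟨T, τ, hτ⟩ := τ
  obtain rfl : S = T := h
  obtain ⟨x, hx⟩ := S.nonempty
  have hne : ∀ x, σ x ≠ 0 := fun x h => by simpa [h] using hσ.2 x
  have hself : ∀ x, ⟪σ x, σ x⟫_ℂ = 1 := fun x => by
    rw [inner_self_eq_norm_sq_to_K, hσ.2 x]; simp
  -- On each fibre `τ = ⟪σ, τ⟫ σ`, as `σ` is a unit vector of a line; the coefficient is the same at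
  -- all points by `IsCovConst.inner_eq`.
  have key : ∀ y, τ y = ⟪σ ⟨x, hx⟩, τ ⟨x, hx⟩⟫_ℂ • σ y := by
    intro y
    obtain ⟨b, hb⟩ := exists_smul_eq_of_ne_zero (hne y) (τ y)
    rw [hσ.1.inner_eq hL hτ.1 ⟨x, hx⟩ y, hb, inner_smul_right, hself, mul_one]
  have hnorm : ‖⟪σ ⟨x, hx⟩, τ ⟨x, hx⟩⟫_ℂ‖ = 1 := by
    have := congrArg norm (key ⟨x, hx⟩)
    rw [norm_smul, hσ.2, hτ.2, mul_one] at this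
    exact this.symm
  refine ⟨⟨_, mem_sphere_zero_iff_norm.2 hnorm⟩, ?_⟩
  refine ext_of_apply rfl fun y hy hy' => key ⟨y, hy⟩

lemma smooth_proj : DSmooth (proj : Planck Ω a o c → BS Ω a o c) := by
  intro k σ hσ u
  obtain ⟨τ, W, hW, hτ, h⟩ := hσ u
  exact ⟨fun y q => (τ y q).proj, W, hW, (Bundle.contMDiff_proj L).comp_contMDiffOn hτ,
    fun y hy => ⟨(h y hy).1, (h y hy).2.1⟩⟩

lemma smooth_smul : DSmooth fun b : Circle × Planck Ω a o c => b.1 • b.2 := by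
  intro k p hp
  obtain ⟨h1, h2⟩ := isPlot_prod_iff.1 hp
  rw [isPlot_circle_iff] at h1
  intro u
  obtain ⟨τ, W, hW, hτ, h⟩ := h2 u
  refine ⟨fun y q => ⟨(τ y q).proj, ((p y).1 : ℂ) • (τ y q).2⟩, interior W,
    interior_mem_nhds.2 hW, ?_, fun y hy => ?_⟩
  · intro z hz
    have hz' : ContMDiffAt (𝓘(ℝ, Eu k).prod (𝓡 n)) ((𝓡 (2 * n)).prod 𝓘(ℝ, ℂ)) ∞
        (fun z : Eu k × S₀ => τ z.1 z.2) z :=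
      hτ.contMDiffAt (prod_mem_nhds (mem_interior_iff_mem_nhds.1 hz.1) Filter.univ_mem)
    exact (contMDiffAt_smul_along (b := fun z : Eu k × S₀ => (τ z.1 z.2).proj)
      (s := fun z => (τ z.1 z.2).2) (h1.contDiffAt.contMDiffAt.comp z contMDiffAt_fst)
      hz').contMDiffWithinAt
  · obtain ⟨h3, h4, h5⟩ := h y (interior_subset hy)
    exact ⟨h3, h4, fun q hq => congrArg (((p y).1 : ℂ) • ·) (h5 q hq)⟩

end Planck

variable [MeasurableSpace M] {μ : Measure M}

lemma posPairing_iff {ξ : O1 n L μ} {σ : Planck Ω a o c} :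
    PosPairing ξ σ ↔ ∀ x : σ.1.1, 0 < (⟪ξ.dualVec.1 x, σ.2.1 x⟫_ℂ).re ∧
      (⟪ξ.dualVec.1 x, σ.2.1 x⟫_ℂ).im = 0 := by
  constructor
  · rintro ⟨s, h1, h2⟩
    rwa [O1.dualVec_eq s.2 h1]
  · exact fun h => ⟨⟨ξ.dualVec, ξ.dualVec_mem⟩, ξ.apply_dualVec, h⟩

namespace PosPairing

variable {ξ η : O1 n L μ} {σ τ : Planck Ω a o c}

lemma dualVec_ne_zero (h : PosPairing ξ σ) (x : σ.1.1) : ξ.dualVec.1 x ≠ 0 := by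
  intro h0
  have := (posPairing_iff.1 h x).1
  simp [h0] at this

/-- A unit vector in a line with positive product against `s` can only be `s / |s|`. This explicit
formula yields both uniqueness of the cycle and its smooth dependence on `ξ`. -/
lemma planck_apply (h : PosPairing ξ σ) (x : σ.1.1) :
    σ.2.1 x = ((‖ξ.dualVec.1 x‖⁻¹ : ℝ) : ℂ) • ξ.dualVec.1 x := by
  obtain ⟨b, hb⟩ := exists_smul_eq_of_ne_zero (h.dualVec_ne_zero x) (σ.2.1 x)
  exact eq_normalize_of_inner_pos hb (σ.2.2.2 x) (posPairing_iff.1 h x).1 (posPairing_iff.1 h x).2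

lemma planck_unique (h : PosPairing ξ σ) (h' : PosPairing ξ τ) (hp : σ.proj = τ.proj) : σ = τ :=
  Planck.ext_of_apply hp fun x hx hx' => by
    rw [h.planck_apply, h'.planck_apply]

/-- The unit sections differ by a phase `b`, which multiplies the pairing by `conj b`. Both pairings
are positive at one point of the nonempty `S`, so `b = 1`. -/
lemma functional_unique (h : PosPairing ξ σ) (h' : PosPairing η σ) (hp : ξ.proj = η.proj) :
    ξ = η := by
  have hη := η.dualVec_mem
  rw [show η.1 = ξ.1 from hp.symm] at hη
  obtain ⟨b, hb⟩ := exists_smul_eq_of_mem_submodule ξ.dualVec_ne_zero ξ.dualVec_mem hη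
  have hb' : η.dualVec.1 = b • ξ.dualVec.1 := congrArg Subtype.val hb
  obtain ⟨x, hx⟩ := σ.1.nonempty
  obtain ⟨h1, h2⟩ := posPairing_iff.1 h ⟨x, hx⟩
  obtain ⟨h3, h4⟩ := posPairing_iff.1 h' ⟨x, hx⟩
  have hunit := η.l2_dualVec
  rw [hb', l2_smul_left, l2_smul_right, ξ.l2_dualVec, mul_one,
    ← Complex.normSq_eq_conj_mul_self] at hunit
  have hunit' : b.re * b.re + b.im * b.im = 1 := by
    rw [← Complex.normSq_apply]
    exact_mod_cast hunit
  rw [hb', Pi.smul_apply, inner_smul_left] at h3 h4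
  simp only [Complex.mul_re, Complex.mul_im, Complex.conj_re, Complex.conj_im, h2, mul_zero,
    sub_zero, zero_add] at h3 h4
  have him : b.im = 0 := by
    rcases mul_eq_zero.1 h4 with h | h
    · exact neg_eq_zero.1 h
    · exact absurd h h1.ne'
  have hre : 0 < b.re := pos_of_mul_pos_left h3 h1.le
  have hb1 : b = 1 := by
    refine Complex.ext ?_ him
    rw [him] at hunit'
    change b.re = 1
    nlinarith
  refine O1.ext_of_dualVec ?_
  rw [hb, hb1, one_smul]

end PosPairing

end BohrSommerfeld

/-! ### Existence and smoothness of positive partners over `𝒰_SBS(a)`. -/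

section BohrSommerfeld

variable {n : ℕ} {M : Type u} [TopologicalSpace M] [ChartedSpace (Eu (2 * n)) M]
  {L : M → Type v} [TopologicalSpace (TotalSpace ℂ L)]
  [∀ x, NormedAddCommGroup (L x)] [∀ x, InnerProductSpace ℂ (L x)] [FiberBundle ℂ L]
  [VectorBundle ℂ ℂ L] [VectorBundle ℝ ℂ L]
  [IsManifold (𝓡 (2 * n)) ∞ M] [ContMDiffVectorBundle ∞ ℂ L (𝓡 (2 * n))]
  {S₀ : Type u} [TopologicalSpace S₀] [ChartedSpace (Eu n) S₀] [IsManifold (𝓡 n) ∞ S₀]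
  [ConnectedSpace S₀]
  {Ω : TwoForm n M} {a : HermitianConnection n L} {o : Homology n S₀} {c : Homology n M}
  [MeasurableSpace M] {μ : Measure M}

lemma O1.exists_proj_eq [T2Space M] [CompactSpace M] [BorelSpace M] [IsFiniteMeasure μ]
    [μ.IsOpenPosMeasure] (hL : IsSmoothHermitian n L) {p : ProjSections n L}
    {α : SmoothSections n L} (h0 : α ≠ 0) (hα : α ∈ p.submodule) :
    ∃ ξ : O1 n L μ, ξ.proj = p ∧
      ξ.dualVec = (((√(l2 μ α.1 α.1).re)⁻¹ : ℝ) : ℂ) • α := by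
  have hpos := integral_norm_sq_pos (μ := μ) hL α.2 fun h => h0 (Subtype.ext h)
  refine ⟨O1.ofUnit hL p ((((√(l2 μ α.1 α.1).re)⁻¹ : ℝ) : ℂ) • α)
    (p.submodule.smul_mem _ hα) ?_, rfl, O1.dualVec_ofUnit ..⟩
  change l2 μ (_ • α.1) (_ • α.1) = 1
  rw [l2_smul_left, l2_smul_right, Complex.conj_ofReal, l2_self, Complex.ofReal_re]
  norm_cast
  rw [← mul_assoc, ← mul_inv, Real.mul_self_sqrt hpos.le, inv_mul_cancel₀ hpos.ne']

lemma mem_USBS_of_posPairing (hL : IsSmoothHermitian n L) {ξ : O1 n L μ} {σ : Planck Ω a o c}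
    (h : PosPairing ξ σ) : (ξ.proj, σ.proj) ∈ USBS Ω a o c := by
  refine ⟨ξ.dualVec, ξ.dualVec_ne_zero, ξ.proj_eq_mk, σ.2.1, σ.2.2.1, fun y h => ?_, 0, ?_⟩
  · have := σ.2.2.2 y
    simp [h] at this
  obtain ⟨s, hs, hsσ, -⟩ := σ.2.2.1
  -- The definition asks for `F` on all of `M`, so `σ` is replaced by its global extension `s`. On
  -- `S` this `F` equals `|ξ.dualVec|`, and `θ = 0` suffices.
  refine ⟨fun x => (⟪ξ.dualVec.1 x, s x⟫_ℂ).re, ?_, fun y => ?_⟩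
  · exact Complex.reCLM.contDiff.contMDiff.comp (hL _ ξ.dualVec.2 s hs)
  have h1 := posPairing_iff.1 h y
  have hv := norm_pos_iff.2 (h.dualVec_ne_zero y)
  simp only [hsσ y]
  refine ⟨h1.1, ?_⟩
  have e : ⟪ξ.dualVec.1 y, σ.2.1 y⟫_ℂ = (‖ξ.dualVec.1 y‖ : ℂ) := by
    rw [h.planck_apply y, inner_smul_right, inner_self_eq_norm_sq_to_K]
    change ((‖ξ.dualVec.1 y‖⁻¹ : ℝ) : ℂ) * ((‖ξ.dualVec.1 y‖ : ℝ) : ℂ) ^ 2 = _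
    norm_cast
    field_simp
  rw [e, h.planck_apply y, smul_smul]
  simp only [Complex.ofReal_zero, zero_mul, Complex.exp_zero, one_mul, Complex.ofReal_re]
  rw [← Complex.ofReal_mul, mul_inv_cancel₀ hv.ne', Complex.ofReal_one, one_smul]

lemma exists_planck_of_mem_USBS (hL : IsSmoothHermitian n L)
    {x : ProjSections n L × BS Ω a o c} (hx : x ∈ USBS Ω a o c) {ξ : O1 n L μ}
    (hξ : ξ.proj = x.1) : ∃ σ : Planck Ω a o c, σ.proj = x.2 ∧ PosPairing ξ σ := by
  obtain ⟨α, hα0, hp, σ, hσ, hσ0, θ, F, -, hF⟩ := hx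
  obtain ⟨b, hb⟩ := exists_smul_eq_of_mem_submodule hα0
    (mem_submodule_of_eq_mk (p := ξ.1) (hξ.trans hp)) ξ.dualVec_mem
  have hb0 : b ≠ 0 := by
    rintro rfl
    exact ξ.dualVec_ne_zero (by rw [hb, zero_smul])
  obtain ⟨x₀, hx₀⟩ := x.2.nonempty
  set w : ℂ := b * Complex.exp (θ * Complex.I) with hw
  have hw0 : w ≠ 0 := mul_ne_zero hb0 (Complex.exp_ne_zero _)
  set r := ‖σ ⟨x₀, hx₀⟩‖ with hr
  have hr0 : 0 < r := norm_pos_iff.2 (hσ0 _)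
  have hnorm : ∀ y, ‖σ y‖ = r := by
    intro y
    have h1 := hσ.inner_eq hL hσ y ⟨x₀, hx₀⟩
    rw [inner_self_eq_norm_sq_to_K, inner_self_eq_norm_sq_to_K] at h1
    have h2 : ‖σ y‖ ^ 2 = r ^ 2 := by exact_mod_cast h1
    exact (sq_eq_sq₀ (norm_nonneg _) hr0.le).1 h2
  have hwn : 0 < ‖w‖ := norm_pos_iff.2 hw0
  -- Along `S` the unit section is `w F σ`. Multiplying `σ` by the phase of `w` aligns the two, and
  -- dividing by the constant length `r` makes it a unit section.
  set z : ℂ := w * (((‖w‖ * r)⁻¹ : ℝ) : ℂ) with hz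
  have hzn : ‖z‖ * r = 1 := by
    rw [hz, norm_mul, Complex.norm_real, Real.norm_of_nonneg (by positivity)]
    field_simp
  have hpair : ∀ y : x.2.1, ⟪ξ.dualVec.1 y, z • σ y⟫_ℂ = ((‖w‖ * F y * r : ℝ) : ℂ) := by
    intro y
    have h1 : ξ.dualVec.1 y = (w * F y) • σ y := by
      rw [hb]
      change b • α.1 y = _
      rw [(hF y).2, smul_smul]
      congr 1
      ring
    have e : (starRingEnd ℂ) w * w = ((‖w‖ ^ 2 : ℝ) : ℂ) := by
      rw [← Complex.normSq_eq_conj_mul_self, Complex.normSq_eq_norm_sq]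
    rw [h1, inner_smul_left, inner_smul_right, inner_self_eq_norm_sq_to_K, hnorm, map_mul,
      Complex.conj_ofReal]
    calc (starRingEnd ℂ) w * (F y : ℂ) * (w * (((‖w‖ * r)⁻¹ : ℝ) : ℂ) * (r : ℂ) ^ 2)
        = ((starRingEnd ℂ) w * w) * (F y : ℂ) * (((‖w‖ * r)⁻¹ : ℝ) : ℂ) * (r : ℂ) ^ 2 := by ring
      _ = _ := by
        rw [e]
        norm_cast
        field_simp
  refine ⟨⟨x.2, z • σ, hσ.smul z, fun y => ?_⟩, rfl, posPairing_iff.2 fun y => ?_⟩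
  · change ‖z • σ y‖ = 1
    rw [norm_smul, hnorm, hzn]
  · change 0 < (⟪ξ.dualVec.1 y, z • σ y⟫_ℂ).re ∧ (⟪ξ.dualVec.1 y, z • σ y⟫_ℂ).im = 0
    have hFy := (hF y).1
    rw [hpair y, Complex.ofReal_re, Complex.ofReal_im]
    exact ⟨by positivity, rfl⟩

/-- Any unit functional over the line has some partner `τ` over `S`. Since `τ` and `σ` differ by a
constant phase, rotating the functional by that phase makes `σ` its partner. -/
lemma exists_functional_of_mem_USBS [T2Space M] [CompactSpace M] [BorelSpace M] [IsFiniteMeasure μ]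
    [μ.IsOpenPosMeasure] (hL : IsSmoothHermitian n L)
    {x : ProjSections n L × BS Ω a o c} (hx : x ∈ USBS Ω a o c) {σ : Planck Ω a o c}
    (hσ : σ.proj = x.2) : ∃ ξ : O1 n L μ, ξ.proj = x.1 ∧ PosPairing ξ σ := by
  obtain ⟨ξ, hξ, -⟩ := O1.exists_proj_eq (μ := μ) (p := x.1) hL x.1.rep_nonzero
    (by rw [Projectivization.submodule_eq]; exact Submodule.mem_span_singleton_self _)
  obtain ⟨τ, hτ, h⟩ := exists_planck_of_mem_USBS hL hx hξ
  obtain ⟨g, rfl⟩ := Planck.exists_smul_eq hL (hτ.trans hσ.symm)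
  exact ⟨g • ξ, hξ, h.smul g⟩

/-- The Planckian cycles paired with a smooth family of functionals form a smooth family. -/
lemma isPlot_planck_of_posPairing [T2Space M] (hL : IsSmoothHermitian n L) {k : ℕ}
    {ξ : Eu k → O1 n L μ} {σ : Eu k → Planck Ω a o c} (hξ : IsPlot ξ)
    (hσ : IsPlot fun u => (σ u).proj) (h : ∀ u, PosPairing (ξ u) (σ u)) : IsPlot σ := by
  intro u
  obtain ⟨f, W, hW, hf, hfW⟩ := hσ u
  have hs := O1.isPlot_iff.1 hξ u
  refine ⟨fun y q => ⟨f y q, ((‖(ξ y).dualVec.1 (f y q)‖⁻¹ : ℝ) : ℂ) • (ξ y).dualVec.1 (f y q)⟩, _,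
    Filter.inter_mem (interior_mem_nhds.2 hW) hs, ?_, fun y hy => ?_⟩
  · rintro ⟨y, q⟩ ⟨⟨hy, hys⟩, -⟩
    have hf' : ContMDiffAt (𝓘(ℝ, Eu k).prod (𝓡 n)) (𝓡 (2 * n)) ∞
        (fun z : Eu k × S₀ => f z.1 z.2) (y, q) :=
      hf.contMDiffAt (prod_mem_nhds (mem_interior_iff_mem_nhds.1 hy) Filter.univ_mem)
    have hs' : ContMDiffAt (𝓘(ℝ, Eu k).prod (𝓡 n)) ((𝓡 (2 * n)).prod 𝓘(ℝ, ℂ)) ∞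
        (fun z : Eu k × S₀ => TotalSpace.mk' ℂ (f z.1 z.2) ((ξ z.1).dualVec.1 (f z.1 z.2)))
        (y, q) :=
      ContMDiffAt.comp (y, q)
        (g := fun z : Eu k × M => TotalSpace.mk' ℂ z.2 ((ξ z.1).dualVec.1 z.2))
        (hys (f y q)) (contMDiffAt_fst.prodMk hf')
    have hq : f y q ∈ (σ y).1.1 := by
      rw [show (σ y).1.1 = _ from (hfW y (interior_subset hy)).2.symm]
      exact ⟨q, rfl⟩
    have hpos : 0 < ‖(ξ y).dualVec.1 (f y q)‖ := norm_pos_iff.2 ((h y).dualVec_ne_zero ⟨_, hq⟩)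
    -- Writing the norm as `√Re ⟪s, s⟫` gives its smoothness where `s ≠ 0`, which positivity of the
    -- pairing guarantees along `S`.
    have hsq : ∀ z : Eu k × S₀, ‖(ξ z.1).dualVec.1 (f z.1 z.2)‖ =
        √(⟪(ξ z.1).dualVec.1 (f z.1 z.2), (ξ z.1).dualVec.1 (f z.1 z.2)⟫_ℂ).re := fun z => by
      rw [norm_eq_sqrt_re_inner (𝕜 := ℂ)]; rfl
    have hcd : ContDiffAt ℝ ∞ (fun w : ℂ => (((√w.re)⁻¹ : ℝ) : ℂ))
        ⟪(ξ y).dualVec.1 (f y q), (ξ y).dualVec.1 (f y q)⟫_ℂ := by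
      have hne := hsq (y, q) ▸ hpos
      refine Complex.ofRealCLM.contDiff.contDiffAt.comp _ (ContDiffAt.inv ?_ hne.ne')
      exact (Complex.reCLM.contDiff.contDiffAt).sqrt (Real.sqrt_pos.1 hne).ne'
    have hn : ContMDiffAt (𝓘(ℝ, Eu k).prod (𝓡 n)) 𝓘(ℝ, ℂ) ∞
        (fun z : Eu k × S₀ => ((‖(ξ z.1).dualVec.1 (f z.1 z.2)‖⁻¹ : ℝ) : ℂ)) (y, q) := by
      simp_rw [hsq]
      exact ContMDiffAt.comp (y, q) (g := fun w : ℂ => (((√w.re)⁻¹ : ℝ) : ℂ)) hcd.contMDiffAt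
        (contMDiffAt_inner_along hL hs' hs')
    exact (contMDiffAt_smul_along hn hs').contMDiffWithinAt
  · obtain ⟨h1, h2⟩ := hfW y (interior_subset hy.1)
    exact ⟨h1, h2, fun q hq => ((h y).planck_apply ⟨_, hq⟩).symm⟩

/-- A family of unit functionals whose phase relative to a smooth family of sections is smooth is
itself smooth. -/
lemma smoothNear_dualVec_of_phase [T2Space M] [CompactSpace M] [BorelSpace M]
    [IsFiniteMeasure μ] [μ.IsOpenPosMeasure] (hL : IsSmoothHermitian n L) {k : ℕ}
    {ξ : Eu k → O1 n L μ} {α : Eu k → SmoothSections n L} {g : Eu k → ℂ} {u : Eu k}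
    (hα : IsLift (fun y => (ξ y).proj) α u) (hgc : ∀ᶠ y in 𝓝 u, ContDiffAt ℝ ∞ g y)
    (hpos : ∀ᶠ y in 𝓝 u, ∀ d : ℂ, (ξ y).dualVec.1 = d • (α y).1 →
      0 < ((starRingEnd ℂ) d * g y).re ∧ ((starRingEnd ℂ) d * g y).im = 0) :
    SmoothNear (n := n) (fun y => (ξ y).dualVec.1) u := by
  obtain ⟨hα, hp⟩ := hα
  rw [isSmoothFamily_iff] at hα
  set N : Eu k → ℂ := fun y => l2 μ (α y).1 (α y).1 with hN
  -- In `s = d α`, positivity of `conj(d) g` gives `d` the phase of `g`, and `⟪s, s⟫ = 1` gives `|d|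
  -- = N^(-1/2)`. So `d` must be `l`, which is smooth because `g` and `N` are.
  set l : Eu k → ℂ := fun y => g y * (((‖g y‖ * √(N y).re)⁻¹ : ℝ) : ℂ) with hl
  have hdual : ∀ᶠ y in 𝓝 u, g y ≠ 0 ∧ 0 < (N y).re ∧ (ξ y).dualVec.1 = l y • (α y).1 := by
    filter_upwards [hp, hpos] with y ⟨hy0, hy⟩ hpos
    obtain ⟨d, hd⟩ := exists_smul_eq_of_mem_submodule hy0
      (mem_submodule_of_eq_mk (p := (ξ y).1) hy) (ξ y).dualVec_mem
    have hd' : (ξ y).dualVec.1 = d • (α y).1 := congrArg Subtype.val hd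
    replace hpos := hpos d hd'
    have hNpos : 0 < (N y).re := by
      rw [hN]
      simp only [l2_self, Complex.ofReal_re]
      exact integral_norm_sq_pos hL (α y).2 fun h => hy0 (Subtype.ext h)
    have hNr : N y = ((N y).re : ℂ) := by
      rw [hN]
      simp only [l2_self, Complex.ofReal_re]
    have hunit := (ξ y).l2_dualVec
    rw [hd', l2_smul_left, l2_smul_right, ← mul_assoc, ← Complex.normSq_eq_conj_mul_self] at hunit
    change _ * N y = 1 at hunit
    rw [hNr, Complex.normSq_eq_norm_sq] at hunit
    have hunit' : ‖d‖ ^ 2 * (N y).re = 1 := by exact_mod_cast hunit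
    have hg0 : g y ≠ 0 := by
      intro h0
      simp [h0] at hpos
    refine ⟨hg0, hNpos, ?_⟩
    have hgn : 0 < ‖g y‖ := norm_pos_iff.2 hg0
    have hre : (starRingEnd ℂ) d * g y = ((‖d‖ * ‖g y‖ : ℝ) : ℂ) := by
      have e1 : (starRingEnd ℂ) d * g y = ((((starRingEnd ℂ) d * g y).re : ℝ) : ℂ) :=
        Complex.ext rfl (by simpa using hpos.2)
      have e2 : ‖(starRingEnd ℂ) d * g y‖ = ((starRingEnd ℂ) d * g y).re := by
        rw [e1, Complex.norm_real, Real.norm_of_nonneg hpos.1.le, Complex.ofReal_re]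
      rw [e1, ← e2, norm_mul, Complex.norm_conj]
    have hdn : ‖d‖ = (√(N y).re)⁻¹ := by
      refine (sq_eq_sq₀ (norm_nonneg _) (by positivity)).1 ?_
      rw [inv_pow, Real.sq_sqrt hNpos.le]
      exact eq_inv_of_mul_eq_one_left hunit'
    have hdg : d * (starRingEnd ℂ) (g y) = ((‖d‖ * ‖g y‖ : ℝ) : ℂ) := by
      have := congrArg (starRingEnd ℂ) hre
      simpa using this
    have hgg : (starRingEnd ℂ) (g y) * g y = ((‖g y‖ ^ 2 : ℝ) : ℂ) := by
      rw [← Complex.normSq_eq_conj_mul_self, Complex.normSq_eq_norm_sq]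
    have hdl : d = l y := by
      have e3 : d * ((‖g y‖ ^ 2 : ℝ) : ℂ) = ((‖d‖ * ‖g y‖ : ℝ) : ℂ) * g y := by
        rw [← hgg, ← hdg]; ring
      have e4 : ((‖g y‖ ^ 2 : ℝ) : ℂ) ≠ 0 := by
        rw [Complex.ofReal_ne_zero]; positivity
      rw [← mul_div_cancel_right₀ d e4, e3, hl, hdn, mul_comm, mul_div_assoc]
      congr 1
      norm_cast
      field_simp
    rw [hd', hdl]
  have hNc : ∀ᶠ y in 𝓝 u, ContDiffAt ℝ ∞ N y :=
    hα.eventually.mono fun y hy => hy.contDiffAt_l2 hL hy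
  have hlc : ∀ᶠ y in 𝓝 u, ContDiffAt ℝ ∞ l y := by
    filter_upwards [hgc, hNc, hdual] with y hgy hNy ⟨hg0, hN0, _⟩
    refine hgy.mul (Complex.ofRealCLM.contDiff.contDiffAt.comp _ (ContDiffAt.inv ?_ ?_))
    · exact (hgy.norm ℂ hg0).mul
        ((Complex.reCLM.contDiff.contDiffAt.comp y hNy).sqrt hN0.ne')
    · have := norm_pos_iff.2 hg0
      have := Real.sqrt_pos.2 hN0
      positivity
  refine (hα.smul hlc).congr ?_
  filter_upwards [hdual] with y hy
  exact hy.2.2.symm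

/-- The functionals paired with a smooth family of Planckian cycles form a smooth family. -/
lemma isPlot_functional_of_posPairing [T2Space M] [CompactSpace M] [BorelSpace M]
    [IsFiniteMeasure μ] [μ.IsOpenPosMeasure] (hL : IsSmoothHermitian n L) {k : ℕ}
    {ξ : Eu k → O1 n L μ} {σ : Eu k → Planck Ω a o c} (hξ : IsPlot fun u => (ξ u).proj)
    (hσ : IsPlot σ) (h : ∀ u, PosPairing (ξ u) (σ u)) : IsPlot ξ := by
  rw [O1.isPlot_iff]
  intro u
  obtain ⟨α, hlift⟩ := hξ u
  obtain ⟨τ, W, hW, hτ, hτW⟩ := hσ u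
  have hα := isSmoothFamily_iff.1 hlift.1
  -- One point of `S₀` suffices: the pairing of `α` with the cycle at the image of `q` supplies the
  -- smooth phase.
  obtain ⟨q⟩ : Nonempty S₀ := inferInstance
  set b : Eu k → M := fun y => (τ y q).proj with hb
  refine smoothNear_dualVec_of_phase (g := fun y => ⟪(α y).1 (b y), (τ y q).2⟫_ℂ) hL hlift ?_ ?_
  · filter_upwards [hα, interior_mem_nhds.2 hW] with y hy hyW
    have hτ' : ContMDiffAt 𝓘(ℝ, Eu k) ((𝓡 (2 * n)).prod 𝓘(ℝ, ℂ)) ∞ (fun y => τ y q) y :=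
      ContMDiffAt.comp y (g := fun z : Eu k × S₀ => τ z.1 z.2)
        (hτ.contMDiffAt (prod_mem_nhds (mem_interior_iff_mem_nhds.1 hyW) Filter.univ_mem))
        (contMDiffAt_id.prodMk contMDiffAt_const)
    have hbc : ContMDiffAt 𝓘(ℝ, Eu k) (𝓡 (2 * n)) ∞ b y := (contMDiffAt_totalSpace.1 hτ').1
    have hα' : ContMDiffAt 𝓘(ℝ, Eu k) ((𝓡 (2 * n)).prod 𝓘(ℝ, ℂ)) ∞
        (fun y => TotalSpace.mk' ℂ (b y) ((α y).1 (b y))) y :=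
      ContMDiffAt.comp y (g := fun z : Eu k × M => TotalSpace.mk' ℂ z.2 ((α z.1).1 z.2))
        (hy (b y)) (contMDiffAt_id.prodMk hbc)
    exact (contMDiffAt_inner_along hL (b := b) (t := fun y => (τ y q).2) hα' hτ').contDiffAt
  · filter_upwards [hW] with y hyW d hd
    obtain ⟨-, hr, hsnd⟩ := hτW y hyW
    have hbS : b y ∈ (σ y).1.1 := by rw [← hr]; exact ⟨q, rfl⟩
    have hpos := posPairing_iff.1 (h y) ⟨b y, hbS⟩
    rwa [hd, ← hsnd q hbS, Pi.smul_apply, inner_smul_left] at hpos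

end BohrSommerfeld

/-! ### The bundle `ℒ` as the graph of the canonical isomorphism. -/

section BohrSommerfeld

variable {n : ℕ} {M : Type u} [TopologicalSpace M] [ChartedSpace (Eu (2 * n)) M]
  {L : M → Type v} [TopologicalSpace (TotalSpace ℂ L)]
  [∀ x, NormedAddCommGroup (L x)] [∀ x, InnerProductSpace ℂ (L x)] [FiberBundle ℂ L]
  [VectorBundle ℂ ℂ L] [VectorBundle ℝ ℂ L]
  [IsManifold (𝓡 (2 * n)) ∞ M] [ContMDiffVectorBundle ∞ ℂ L (𝓡 (2 * n))]
  {S₀ : Type u} [TopologicalSpace S₀] [ChartedSpace (Eu n) S₀] [IsManifold (𝓡 n) ∞ S₀]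
  [ConnectedSpace S₀]
  {Ω : TwoForm n M} {a : HermitianConnection n L} {o : Homology n S₀} {c : Homology n M}
  [MeasurableSpace M] {μ : Measure M} {k : ℕ} {V : Set (ProjSections n L × BS Ω a o c)}

lemma isPlot_base_iff {x : Eu k → V} :
    IsPlot x ↔ IsPlot (fun u => (x u).1.1) ∧ IsPlot fun u => (x u).1.2 :=
  isPlot_prod_iff (f := fun u => (x u).1)

lemma isPlot_O1Over_iff {e : Eu k → O1Over μ V} :
    IsPlot e ↔ IsPlot (fun u => (e u).proj) ∧ IsPlot fun u => (e u).1.2 :=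
  isPlot_prod_iff (f := fun u => (e u).1)

lemma isPlot_planckOver_iff {e : Eu k → PlanckOver V} :
    IsPlot e ↔ IsPlot (fun u => (e u).proj) ∧ IsPlot fun u => (e u).1.2 :=
  isPlot_prod_iff (f := fun u => (e u).1)

lemma isPlot_univBundle_iff' {e : Eu k → UnivBundle Ω a o c μ} :
    IsPlot e ↔ IsPlot (fun u => (e u).1.1) ∧ IsPlot fun u => (e u).1.2 :=
  isPlot_prod_iff (f := fun u => (e u).1)

namespace UnivBundle

lemma functional_proj (e : UnivBundle Ω a o c μ) : e.1.1.1.2.proj = e.proj.1.1 := e.1.1.2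

lemma planck_proj (e : UnivBundle Ω a o c μ) : e.1.2.1.2.proj = e.proj.1.2 :=
  e.1.2.2.trans (congrArg (fun x : USBS Ω a o c => x.1.2) e.2.1.symm)

/-- The base point is recovered smoothly from the two components through their projections, so only
the functional and the cycle need to be checked. -/
lemma isPlot_iff {e : Eu k → UnivBundle Ω a o c μ} :
    IsPlot e ↔ IsPlot (fun u => (e u).1.1.1.2) ∧ IsPlot fun u => (e u).1.2.1.2 := by
  rw [isPlot_univBundle_iff', isPlot_O1Over_iff, isPlot_planckOver_iff]
  refine ⟨fun h => ⟨h.1.2, h.2.2⟩, fun h => ?_⟩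
  have hbase : IsPlot fun u => (e u).proj := by
    have h1 : (fun u => (e u).proj.1.1) = fun u => (e u).1.1.1.2.proj :=
      funext fun u => (e u).functional_proj.symm
    have h2 : (fun u => (e u).proj.1.2) = fun u => (e u).1.2.1.2.proj :=
      funext fun u => (e u).planck_proj.symm
    rw [isPlot_base_iff, h1, h2]
    exact ⟨O1.smooth_proj _ _ h.1, Planck.smooth_proj _ _ h.2⟩
  have hbase' : IsPlot fun u => (e u).1.2.proj := by
    have : (fun u => (e u).1.2.proj) = fun u => (e u).proj := funext fun u => (e u).2.1.symm
    rw [this]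
    exact hbase
  exact ⟨⟨hbase, h.1⟩, hbase', h.2⟩

lemma isPlot_functional {e : Eu k → UnivBundle Ω a o c μ} (he : IsPlot e) :
    IsPlot fun u => (e u).1.1.1.2 := (isPlot_iff.1 he).1

lemma smooth_fst : DSmooth fun e : UnivBundle Ω a o c μ => e.1.1 := fun _ _ he =>
  (isPlot_univBundle_iff'.1 he).1

lemma smooth_snd : DSmooth fun e : UnivBundle Ω a o c μ => e.1.2 := fun _ _ he =>
  (isPlot_univBundle_iff'.1 he).2

lemma smooth_proj : DSmooth (proj : UnivBundle Ω a o c μ → USBS Ω a o c) := fun _ _ he =>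
  (isPlot_O1Over_iff.1 (isPlot_univBundle_iff'.1 he).1).1

lemma smooth_smul : DSmooth fun b : Circle × UnivBundle Ω a o c μ => b.1 • b.2 := by
  intro k p hp
  obtain ⟨h1, h2⟩ := isPlot_prod_iff.1 hp
  obtain ⟨h3, h4⟩ := isPlot_iff.1 h2
  exact isPlot_iff.2 ⟨O1.smooth_smul k (fun u => ((p u).1, (p u).2.1.1.1.2))
    (isPlot_prod_iff.2 ⟨h1, h3⟩), Planck.smooth_smul k (fun u => ((p u).1, (p u).2.1.2.1.2))
    (isPlot_prod_iff.2 ⟨h1, h4⟩)⟩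

lemma ext_of_proj {e e' : UnivBundle Ω a o c μ} (hp : e.proj = e'.proj)
    (h1 : e.1.1.1.2 = e'.1.1.1.2) (h2 : e.1.2.1.2 = e'.1.2.1.2) : e = e' := by
  refine Subtype.ext (Prod.ext (Subtype.ext (Prod.ext hp h1)) (Subtype.ext (Prod.ext ?_ h2)))
  exact e.2.1.symm.trans (hp.trans e'.2.1)

lemma fst_injective : Function.Injective fun e : UnivBundle Ω a o c μ => e.1.1 := by
  intro e e' h
  have hp : e.proj = e'.proj := congrArg O1Over.proj h
  have h1 : e.1.1.1.2 = e'.1.1.1.2 := congrArg (fun x : O1Over μ (USBS Ω a o c) => x.1.2) h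
  refine ext_of_proj hp h1 (e.2.2.planck_unique (h1 ▸ e'.2.2) ?_)
  rw [e.planck_proj, e'.planck_proj, hp]

lemma snd_injective : Function.Injective fun e : UnivBundle Ω a o c μ => e.1.2 := by
  intro e e' h
  have hp : e.proj = e'.proj :=
    e.2.1.trans ((congrArg PlanckOver.proj h).trans e'.2.1.symm)
  have h1 : e.1.2.1.2 = e'.1.2.1.2 := congrArg (fun x : PlanckOver (USBS Ω a o c) => x.1.2) h
  refine ext_of_proj hp (e.2.2.functional_unique (h1 ▸ e'.2.2) ?_) h1
  rw [e.functional_proj, e'.functional_proj, hp]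

lemma fst_surjective (hL : IsSmoothHermitian n L) :
    Function.Surjective fun e : UnivBundle Ω a o c μ => e.1.1 := by
  intro e
  obtain ⟨σ, hσ, h⟩ := exists_planck_of_mem_USBS hL e.1.1.2 e.2
  exact ⟨⟨(e, ⟨(e.1.1, σ), hσ⟩), rfl, h⟩, rfl⟩

variable [T2Space M] [CompactSpace M] [BorelSpace M] [IsFiniteMeasure μ] [μ.IsOpenPosMeasure]

lemma snd_surjective (hL : IsSmoothHermitian n L) :
    Function.Surjective fun e : UnivBundle Ω a o c μ => e.1.2 := by
  intro e
  obtain ⟨ξ, hξ, h⟩ := exists_functional_of_mem_USBS (μ := μ) hL e.1.1.2 e.2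
  exact ⟨⟨(⟨(e.1.1, ξ), hξ⟩, e), rfl, h⟩, rfl⟩

variable (Ω a o c μ) in
/-- The projection `ℒ ≃ p₁^* 𝒪(1)`. -/
noncomputable def equivO1Over (hL : IsSmoothHermitian n L) :
    UnivBundle Ω a o c μ ≃ O1Over μ (USBS Ω a o c) :=
  Equiv.ofBijective (fun e => e.1.1) ⟨fst_injective, fst_surjective hL⟩

variable (Ω a o c μ) in
/-- The projection `ℒ ≃ p₂^* 𝒫_S(a)`. -/
noncomputable def equivPlanckOver (hL : IsSmoothHermitian n L) :
    UnivBundle Ω a o c μ ≃ PlanckOver (USBS Ω a o c) :=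
  Equiv.ofBijective (fun e => e.1.2) ⟨snd_injective, snd_surjective hL⟩

/-- Bijectivity is existence and uniqueness of the paired cycle; smoothness of the inverse is smooth
dependence of that cycle on the functional and on `S`. -/
lemma isCircleBundleIso_equivO1Over (hL : IsSmoothHermitian n L) :
    IsCircleBundleIso UnivBundle.proj O1Over.proj (equivO1Over Ω a o c μ hL) where
  smooth := smooth_fst
  smooth_symm k e he := by
    obtain ⟨h1, h2⟩ := isPlot_O1Over_iff.1 he
    set E := fun u => (equivO1Over Ω a o c μ hL).symm (e u) with hE
    have hfst : ∀ u, (E u).1.1 = e u := fun u => (equivO1Over Ω a o c μ hL).apply_symm_apply (e u)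
    have h3 : IsPlot fun u => (E u).1.1.1.2 := by
      simp only [hfst]
      exact h2
    refine isPlot_iff.2 ⟨h3, isPlot_planck_of_posPairing hL h3 ?_ fun u => (E u).2.2⟩
    have h4 : (fun u => (E u).1.2.1.2.proj) = fun u => (e u).proj.1.2 := by
      funext u
      rw [planck_proj, ← hfst u]
      rfl
    exact (congrArg IsPlot h4).mpr (isPlot_base_iff.1 h1).2
  proj _ := rfl
  map_smul _ _ := rfl

lemma isCircleBundleIso_equivPlanckOver (hL : IsSmoothHermitian n L) :
    IsCircleBundleIso UnivBundle.proj PlanckOver.proj (equivPlanckOver Ω a o c μ hL) where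
  smooth := smooth_snd
  smooth_symm k e he := by
    obtain ⟨h1, h2⟩ := isPlot_planckOver_iff.1 he
    set E := fun u => (equivPlanckOver Ω a o c μ hL).symm (e u) with hE
    have hsnd : ∀ u, (E u).1.2 = e u := fun u =>
      (equivPlanckOver Ω a o c μ hL).apply_symm_apply (e u)
    have h3 : IsPlot fun u => (E u).1.2.1.2 := by
      simp only [hsnd]
      exact h2
    refine isPlot_iff.2 ⟨isPlot_functional_of_posPairing hL ?_ h3 fun u => (E u).2.2, h3⟩
    have h4 : (fun u => (E u).1.1.1.2.proj) = fun u => (e u).proj.1.1 := by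
      funext u
      rw [functional_proj, ← hsnd u]
      exact congrArg (fun x : USBS Ω a o c => x.1.1) (E u).2.1
    exact (congrArg IsPlot h4).mpr (isPlot_base_iff.1 h1).1
  proj e := e.2.1.symm
  map_smul _ _ := rfl

end UnivBundle

/-! ### The canonical isomorphism: existence, uniqueness, maximality of `𝒰_SBS(a)`. -/

section CanonicalIso

variable [T2Space M] [CompactSpace M] [BorelSpace M] [IsFiniteMeasure μ] [μ.IsOpenPosMeasure]

lemma isCanonicalIso_univBundle (hL : IsSmoothHermitian n L) :
    IsCanonicalIso ((UnivBundle.equivO1Over Ω a o c μ hL).symm.trans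
      (UnivBundle.equivPlanckOver Ω a o c μ hL)) := by
  set Φ₁ := UnivBundle.equivO1Over Ω a o c μ hL
  set Φ₂ := UnivBundle.equivPlanckOver Ω a o c μ hL
  have h₁ : IsCircleBundleIso UnivBundle.proj O1Over.proj Φ₁ :=
    UnivBundle.isCircleBundleIso_equivO1Over hL
  have h₂ : IsCircleBundleIso UnivBundle.proj PlanckOver.proj Φ₂ :=
    UnivBundle.isCircleBundleIso_equivPlanckOver hL
  refine ⟨⟨h₂.smooth.comp h₁.smooth_symm, h₁.smooth.comp h₂.smooth_symm, fun e => ?_,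
    fun g e => ?_⟩, fun e => ?_⟩
  · obtain ⟨e, rfl⟩ := Φ₁.surjective e
    rw [Equiv.trans_apply, Φ₁.symm_apply_apply, h₂.proj, h₁.proj]
  · obtain ⟨e, rfl⟩ := Φ₁.surjective e
    rw [← h₁.map_smul]
    simp only [Equiv.trans_apply, Φ₁.symm_apply_apply, h₂.map_smul]
  · obtain ⟨e, rfl⟩ := Φ₁.surjective e
    rw [Equiv.trans_apply, Φ₁.symm_apply_apply]
    exact e.2.2

lemma IsCanonicalIso.unique {Φ Ψ : O1Over μ V ≃ PlanckOver V} (hΦ : IsCanonicalIso Φ)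
    (hΨ : IsCanonicalIso Ψ) : Φ = Ψ := by
  ext e : 1
  have hp : (Φ e).1.1 = (Ψ e).1.1 := (hΦ.proj e).trans (hΨ.proj e).symm
  refine Subtype.ext (Prod.ext hp ((hΦ.pos e).planck_unique (hΨ.pos e) ?_))
  rw [(Φ e).2, (Ψ e).2, hp]

/-- Every line contains a unit section, so the fibre of `p₁^* 𝒪(1)` over a point of `V` is nonempty.
The image of one of its elements is a positive partner, which places the point in `𝒰_SBS(a)`. -/
lemma IsCanonicalIso.subset_USBS (hL : IsSmoothHermitian n L) {Φ : O1Over μ V ≃ PlanckOver V}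
    (hΦ : IsCanonicalIso Φ) : V ⊆ USBS Ω a o c := by
  intro x hx
  obtain ⟨ξ, hξ, -⟩ := O1.exists_proj_eq (μ := μ) (p := x.1) hL x.1.rep_nonzero
    (mem_submodule_of_eq_mk x.1.mk_rep.symm)
  set e : O1Over μ V := ⟨(⟨x, hx⟩, ξ), hξ⟩
  have h := mem_USBS_of_posPairing hL (hΦ.pos e)
  have hp : (Φ e).1.1 = ⟨x, hx⟩ := hΦ.proj e
  have h2 : (Φ e).1.2.proj = x.2 := by rw [(Φ e).2, hp]
  rw [h2] at h
  exact (congrArg (· ∈ USBS Ω a o c) (Prod.ext hξ rfl : (ξ.proj, x.2) = x)).mp h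

end CanonicalIso

/-! ### Local triviality of `ℒ`. -/

section LocalTriviality

namespace O1

lemma exists_smul_eq {ξ η : O1 n L μ} (h : ξ.proj = η.proj) : ∃ g : Circle, η = g • ξ := by
  have hη := η.dualVec_mem
  rw [show η.1 = ξ.1 from h.symm] at hη
  obtain ⟨b, hb⟩ := exists_smul_eq_of_mem_submodule ξ.dualVec_ne_zero ξ.dualVec_mem hη
  have hb' : η.dualVec.1 = b • ξ.dualVec.1 := congrArg Subtype.val hb
  have hunit := η.l2_dualVec
  rw [hb', l2_smul_left, l2_smul_right, ξ.l2_dualVec, mul_one,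
    ← Complex.normSq_eq_conj_mul_self, Complex.normSq_eq_norm_sq] at hunit
  have hnorm : ‖b‖ = 1 := by
    have : ‖b‖ ^ 2 = 1 := by exact_mod_cast hunit
    nlinarith [norm_nonneg b]
  have hmem : b ∈ Submonoid.unitSphere ℂ := mem_sphere_zero_iff_norm.2 hnorm
  exact ⟨⟨b, hmem⟩, ext_of_dualVec (hb.trans (dualVec_smul (⟨b, hmem⟩ : Circle) ξ).symm)⟩

lemma l2_dualVec_smul (g : Circle) (ξ : O1 n L μ) :
    l2 μ ξ.dualVec.1 (g • ξ).dualVec.1 = g := by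
  rw [dualVec_smul]
  change l2 μ _ ((g : ℂ) • ξ.dualVec.1) = g
  rw [l2_smul_right, l2_dualVec, mul_one]

end O1

/-- The points over which a functional can be normalized by its value on the section `β`. -/
def normalizableSet (Ω : TwoForm n M) (a : HermitianConnection n L) (o : Homology n S₀)
    (c : Homology n M) (μ : Measure M) (β : SmoothSections n L) : Set (USBS Ω a o c) :=
  {x | ∀ α ∈ x.1.1.submodule, α ≠ 0 → l2 μ α.1 β.1 ≠ 0}

variable [T2Space M] [CompactSpace M] [BorelSpace M] [IsFiniteMeasure μ] [μ.IsOpenPosMeasure]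

lemma mem_normalizableSet_iff {β α : SmoothSections n L} {x : USBS Ω a o c} (hα0 : α ≠ 0)
    (hα : α ∈ x.1.1.submodule) :
    x ∈ normalizableSet Ω a o c μ β ↔ l2 μ α.1 β.1 ≠ 0 := by
  refine ⟨fun h => h α hα hα0, fun h γ hγ hγ0 => ?_⟩
  obtain ⟨b, rfl⟩ := exists_smul_eq_of_mem_submodule hα0 hα hγ
  have hb : b ≠ 0 := by
    rintro rfl
    exact hγ0 (zero_smul _ _)
  change l2 μ (b • α.1) β.1 ≠ 0
  rw [l2_smul_left]
  exact mul_ne_zero ((map_ne_zero _).2 hb) h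

/-- Openness in the D-topology is tested on plots, along which a smooth lift `α` makes `⟪α, β⟫`
continuous; whether it vanishes does not depend on the chosen nonzero vector of the line. -/
lemma isOpen_normalizableSet (hL : IsSmoothHermitian n L) (β : SmoothSections n L) :
    IsOpen[dTopology] (normalizableSet Ω a o c μ β) := by
  rw [isOpen_iff_preimages_plots]
  intro k p hp
  rw [isOpen_iff_mem_nhds]
  intro u hu
  obtain ⟨α, hα, hαp⟩ := (isPlot_base_iff.1 hp).1 u
  obtain ⟨h0, h1⟩ := hαp.self_of_nhds
  have hne := (mem_normalizableSet_iff (μ := μ) h0 (mem_submodule_of_eq_mk h1)).1 hu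
  have hc := (isSmoothFamily_iff.1 hα).contDiffAt_l2 (μ := μ) hL
    (isSmoothFamily_iff.1 (exists_isSmoothFamily_const β u))
  filter_upwards [hαp, hc.continuousAt.eventually_ne hne] with y ⟨hy0, hy⟩ hyne
  exact (mem_normalizableSet_iff hy0 (mem_submodule_of_eq_mk hy)).2 hyne

lemma exists_normalized (hL : IsSmoothHermitian n L) {β : SmoothSections n L} {x : USBS Ω a o c}
    (hx : x ∈ normalizableSet Ω a o c μ β) : ∃ e : UnivBundle Ω a o c μ, e.proj = x ∧
      0 < (l2 μ e.1.1.1.2.dualVec.1 β.1).re ∧ (l2 μ e.1.1.1.2.dualVec.1 β.1).im = 0 := by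
  obtain ⟨ξ, hξ, -⟩ := O1.exists_proj_eq (μ := μ) (p := x.1.1) hL x.1.1.rep_nonzero
    (mem_submodule_of_eq_mk x.1.1.mk_rep.symm)
  have hne := (mem_normalizableSet_iff (μ := μ) (β := β) ξ.dualVec_ne_zero
    (show ξ.dualVec ∈ x.1.1.submodule from hξ ▸ ξ.dualVec_mem)).1 hx
  set z := l2 μ ξ.dualVec.1 β.1 with hz
  have hzn : 0 < ‖z‖ := norm_pos_iff.2 hne
  have hw : ‖z * ((‖z‖⁻¹ : ℝ) : ℂ)‖ = 1 := by
    rw [norm_mul, Complex.norm_real, norm_inv, norm_norm, mul_inv_cancel₀ hzn.ne']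
  -- The phase of `z`: the product is conjugate linear in its first argument, so `⟪g s, β⟫ = conj(g)
  -- z = |z|`.
  set g : Circle := ⟨z * ((‖z‖⁻¹ : ℝ) : ℂ), mem_sphere_zero_iff_norm.2 hw⟩ with hg
  obtain ⟨e, he⟩ := UnivBundle.fst_surjective (μ := μ) hL
    (⟨(x, g • ξ), hξ⟩ : O1Over μ (USBS Ω a o c))
  have he2 : e.1.1.1.2 = g • ξ := congrArg (fun x : O1Over μ (USBS Ω a o c) => x.1.2) he
  refine ⟨e, congrArg O1Over.proj he, ?_⟩
  have hval : l2 μ e.1.1.1.2.dualVec.1 β.1 = (‖z‖ : ℂ) := by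
    rw [he2, O1.dualVec_smul]
    change l2 μ ((g : ℂ) • ξ.dualVec.1) β.1 = _
    rw [l2_smul_left, ← hz]
    change (starRingEnd ℂ) (z * ((‖z‖⁻¹ : ℝ) : ℂ)) * z = _
    rw [map_mul, Complex.conj_ofReal, mul_right_comm, ← Complex.normSq_eq_conj_mul_self,
      Complex.normSq_eq_norm_sq]
    norm_cast
    field_simp
  rw [hval]
  exact ⟨by simpa using hzn, Complex.ofReal_im _⟩

lemma isPlot_of_normalized (hL : IsSmoothHermitian n L) {β : SmoothSections n L}
    {e : Eu k → UnivBundle Ω a o c μ} (hbase : IsPlot fun u => (e u).proj)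
    (hpos : ∀ u, 0 < (l2 μ (e u).1.1.1.2.dualVec.1 β.1).re ∧
      (l2 μ (e u).1.1.1.2.dualVec.1 β.1).im = 0) : IsPlot e := by
  have hξ : IsPlot fun u => (e u).1.1.1.2 := by
    rw [O1.isPlot_iff]
    intro u
    have hproj : (fun u => (e u).proj.1.1) = fun u => (e u).1.1.1.2.proj :=
      funext fun u => (e u).functional_proj.symm
    obtain ⟨α, hα⟩ := (isPlot_base_iff.1 hbase).1 u
    rw [hproj] at hα
    refine smoothNear_dualVec_of_phase (g := fun y => l2 μ (α y).1 β.1) hL hα ?_ ?_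
    · exact (isSmoothFamily_iff.1 hα.1).eventually.mono fun y hy => hy.contDiffAt_l2 hL
        (isSmoothFamily_iff.1 (exists_isSmoothFamily_const β y))
    · refine .of_forall fun y d hd => ?_
      rw [← l2_smul_left, ← hd]
      exact hpos y
  have h1 : IsPlot fun u => (e u).1.1 := isPlot_O1Over_iff.2 ⟨hbase, hξ⟩
  have h2 := (UnivBundle.isCircleBundleIso_equivO1Over hL).smooth_symm k _ h1
  exact (congrArg IsPlot (funext fun u =>
    (UnivBundle.equivO1Over Ω a o c μ hL).symm_apply_apply (e u))).mp h2

lemma isCircleBundle_univBundle (hL : IsSmoothHermitian n L) :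
    IsCircleBundle (UnivBundle.proj : UnivBundle Ω a o c μ → USBS Ω a o c) where
  smooth_proj := UnivBundle.smooth_proj
  smooth_smul := UnivBundle.smooth_smul
  proj_smul _ _ := rfl
  locally_trivial x := by
    -- A vector of the line at `x` itself is not `L²`-orthogonal to that line, so normalization by
    -- `β` is possible near `x`.
    set β := x.1.1.rep
    have hβx : β ∈ x.1.1.submodule := mem_submodule_of_eq_mk x.1.1.mk_rep.symm
    have hxW : x ∈ normalizableSet Ω a o c μ β :=
      (mem_normalizableSet_iff x.1.1.rep_nonzero hβx).2
        (l2_self_ne_zero hL β.2 fun h => x.1.1.rep_nonzero (Subtype.ext h))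
    choose τ hτp hτpos using fun w : normalizableSet Ω a o c μ β => exists_normalized hL w.2
    have hτ : DSmooth τ := by
      intro k w hw
      refine isPlot_of_normalized (β := β) hL ?_ fun u => hτpos (w u)
      exact (congrArg IsPlot (funext fun u => hτp (w u))).mpr (isPlot_subtype_iff.1 hw)
    have hfix : ∀ (w : normalizableSet Ω a o c μ β) (g : Circle), (g • τ w).proj = w.1 :=
      fun w g => hτp w
    set t₀ : normalizableSet Ω a o c μ β × Circle →
        {e : UnivBundle Ω a o c μ // e.proj ∈ normalizableSet Ω a o c μ β} :=
      fun b => ⟨b.2 • τ b.1, by rw [hfix]; exact b.1.2⟩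
    have hproj : ∀ b, (t₀ b).1.proj = b.1.1 := fun b => hfix b.1 b.2
    -- The fibre coordinate is an `L²` product of unit sections, which gives injectivity and, by
    -- smoothness of such products, smoothness of the inverse trivialization.
    have hphase : ∀ b, l2 μ (τ b.1).1.1.1.2.dualVec.1 (t₀ b).1.1.1.1.2.dualVec.1 = b.2 :=
      fun b => O1.l2_dualVec_smul b.2 _
    have hinj : Function.Injective t₀ := by
      intro b b' h
      have h1 : b.1 = b'.1 := Subtype.ext (by rw [← hproj b, ← hproj b', h])
      refine Prod.ext h1 (Circle.ext ?_)
      rw [← hphase b, ← hphase b', h, h1]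
    have hsurj : Function.Surjective t₀ := by
      rintro ⟨e, he⟩
      obtain ⟨g, hg⟩ := O1.exists_smul_eq (ξ := (τ ⟨e.proj, he⟩).1.1.1.2) (η := e.1.1.1.2) (by
        rw [UnivBundle.functional_proj, UnivBundle.functional_proj, hτp])
      refine ⟨(⟨e.proj, he⟩, g), Subtype.ext (UnivBundle.fst_injective ?_)⟩
      exact Subtype.ext (Prod.ext (hproj (⟨e.proj, he⟩, g)) hg.symm)
    have hsymm : ∀ e, t₀ ((Equiv.ofBijective t₀ ⟨hinj, hsurj⟩).symm e) = e :=
      (Equiv.ofBijective t₀ ⟨hinj, hsurj⟩).apply_symm_apply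
    refine ⟨_, isOpen_normalizableSet hL β, hxW, Equiv.ofBijective t₀ ⟨hinj, hsurj⟩, ?_, ?_,
      fun b => hfix _ _, fun w g h => mul_smul g h (τ w)⟩
    · intro k b hb
      obtain ⟨h1, h2⟩ := isPlot_prod_iff.1 hb
      exact UnivBundle.smooth_smul k (fun u => ((b u).2, τ (b u).1))
        (isPlot_prod_iff.2 ⟨h2, hτ k _ h1⟩)
    · intro k e he
      set b := fun u => (Equiv.ofBijective t₀ ⟨hinj, hsurj⟩).symm (e u)
      have hb : ∀ u, t₀ (b u) = e u := fun u => hsymm (e u)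
      have h1 : IsPlot fun u => (b u).1 := by
        have : (fun u => (b u).1.1) = fun u => (e u).1.proj :=
          funext fun u => by rw [← hproj (b u), hb]
        exact (congrArg IsPlot this).mpr (UnivBundle.smooth_proj k _ (isPlot_subtype_iff.1 he))
      refine isPlot_prod_iff.2 ⟨h1, isPlot_circle_iff.2 ?_⟩
      have h2 : (fun u => ((b u).2 : ℂ)) = fun u =>
          l2 μ (τ (b u).1).1.1.1.2.dualVec.1 (e u).1.1.1.1.2.dualVec.1 :=
        funext fun u => by rw [← hphase (b u), hb]
      have h3 := UnivBundle.isPlot_functional (hτ k _ h1)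
      have h4 := UnivBundle.isPlot_functional (isPlot_subtype_iff.1 he)
      refine (congrArg (ContDiff ℝ ∞) h2).mpr (contDiff_iff_contDiffAt.2 fun u => ?_)
      exact (O1.isPlot_iff.1 h3 u).contDiffAt_l2 hL (O1.isPlot_iff.1 h4 u)

end LocalTriviality

/-! ### The connection on `ℒ`. -/

section Connection

variable [T2Space M] [CompactSpace M] [BorelSpace M] [IsFiniteMeasure μ]

lemma isCircleConnection_univConnection (hL : IsSmoothHermitian n L) :
    IsCircleConnection (univConnection Ω a o c μ) := by
  have h := O1.isCircleConnection_chernForm (μ := μ) hL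
  refine ⟨⟨fun k e he => ?_, fun k e he => ?_, fun k m e f he hf => ?_⟩, fun k e γ he hγ => ?_⟩
  · exact h.linear (fun u => (e u).1.1.1.2) (UnivBundle.isPlot_functional he)
  · exact h.smooth (fun u => (e u).1.1.1.2) (UnivBundle.isPlot_functional he)
  · exact h.natural (fun u => (e u).1.1.1.2) f (UnivBundle.isPlot_functional he) hf
  · exact h.gauge (fun u => (e u).1.1.1.2) γ (UnivBundle.isPlot_functional he) hγ

end Connection

end BohrSommerfeld

end SBS

theorem proposition1 {n : ℕ}
    -- the compact simply connected symplectic manifold `(M, Ω)` of dimension `2n`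
    {M : Type u} [TopologicalSpace M] [ChartedSpace (Eu (2 * n)) M]
    [IsManifold (𝓡 (2 * n)) ∞ M] [T2Space M] [CompactSpace M] [SimplyConnectedSpace M]
    [MeasurableSpace M] [BorelSpace M]
    (Ω : TwoForm n M) (hΩ : IsSymplectic Ω)
    -- the prequantization line bundle `L` with its Hermitian structure and connection `a`
    (L : M → Type v) [TopologicalSpace (TotalSpace ℂ L)]
    [∀ x, NormedAddCommGroup (L x)] [∀ x, InnerProductSpace ℂ (L x)] [FiberBundle ℂ L]
    [VectorBundle ℂ ℂ L] [VectorBundle ℝ ℂ L] [ContMDiffVectorBundle ∞ ℂ L (𝓡 (2 * n))]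
    (hL : IsSmoothHermitian n L)
    (a : HermitianConnection n L) (ha : a.IsPrequantum Ω)
    -- the topological type `S₀` and the homology class `c` of the Lagrangian submanifolds
    (S₀ : Type u) [TopologicalSpace S₀] [ChartedSpace (Eu n) S₀] [IsManifold (𝓡 n) ∞ S₀]
    [T2Space S₀] [CompactSpace S₀] [ConnectedSpace S₀]
    (o : Homology n S₀) (ho : IsFundamentalClass o) (c : Homology n M) :
    -- the two bundles are canonically isomorphic over `𝒰_SBS(a)`
    (∃! Φ : O1Over (liouville Ω) (USBS Ω a o c) ≃ PlanckOver (USBS Ω a o c),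
      IsCanonicalIso Φ) ∧
    -- `𝒰_SBS(a)` is the largest subset with this property
    (∀ V : Set (ProjSections n L × BS Ω a o c),
      (∃ Φ : O1Over (liouville Ω) V ≃ PlanckOver V, IsCanonicalIso Φ) → V ⊆ USBS Ω a o c) ∧
    -- `ℒ` is a `U(1)`-bundle, isomorphic to both bundles by the two projections
    IsCircleBundle (UnivBundle.proj : UnivBundle Ω a o c (liouville Ω) → USBS Ω a o c) ∧
    (∃ Φ₁ : UnivBundle Ω a o c (liouville Ω) ≃ O1Over (liouville Ω) (USBS Ω a o c),
      IsCircleBundleIso UnivBundle.proj O1Over.proj Φ₁ ∧ ∀ e, Φ₁ e = e.1.1) ∧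
    (∃ Φ₂ : UnivBundle Ω a o c (liouville Ω) ≃ PlanckOver (USBS Ω a o c),
      IsCircleBundleIso UnivBundle.proj PlanckOver.proj Φ₂ ∧ ∀ e, Φ₂ e = e.1.2) ∧
    -- `p₁^* A` is a connection on `ℒ`, whose curvature is `2π p₁^* Ω_FS`
    IsCircleConnection (univConnection Ω a o c (liouville Ω)) ∧
    ∀ ⦃k : ℕ⦄ (e : Eu k → UnivBundle Ω a o c (liouville Ω)), IsPlot e →
      ∀ (α : Eu k → SmoothSections n L) (y : Eu k), IsLift (fun z => (e z).proj.1.1) α y →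
        ∀ v w : Eu k, (univConnection Ω a o c (liouville Ω)).d e y v w =
          2 * Real.pi * fubiniStudy (liouville Ω) (α y).1
            (fun x => fderiv ℝ (fun z => (α z).1 x) y v)
            (fun x => fderiv ℝ (fun z => (α z).1 x) y w) := by
  -- These two properties of the Liouville measure make the `L²` product finite and definite on
  -- smooth sections.
  have := hΩ.isFiniteMeasure_liouville
  have := hΩ.isOpenPosMeasure_liouville
  refine ⟨⟨_, isCanonicalIso_univBundle hL, fun Ψ hΨ => hΨ.unique (isCanonicalIso_univBundle hL)⟩,
    fun V ⟨Φ, hΦ⟩ => hΦ.subset_USBS hL, isCircleBundle_univBundle hL,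
    ⟨UnivBundle.equivO1Over _ _ _ _ _ hL, UnivBundle.isCircleBundleIso_equivO1Over hL,
      fun _ => rfl⟩,
    ⟨UnivBundle.equivPlanckOver _ _ _ _ _ hL, UnivBundle.isCircleBundleIso_equivPlanckOver hL,
      fun _ => rfl⟩,
    isCircleConnection_univConnection hL, fun k e he α y hα v w => ?_⟩
  have hp : (fun z => (e z).proj.1.1) = fun z => (e z).1.1.1.2.proj :=
    funext fun z => (UnivBundle.functional_proj (e z)).symm
  rw [hp] at hα
  exact O1.d_chernForm_eq_fubiniStudy hL (UnivBundle.isPlot_functional he) hα v w
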